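/- **Setting.** Let $V$ be a set of users, $\mathcal B\subseteq V$ a finite set of broadcasters and $\mathcal E'$ a finite set of candidate links $(i,j)$ with $i\in\mathcal B$, $j\in V$ (adding $(i,j)$ makes $j$ a follower of $i$); let $V'$ be the set of users $j$ with $(i,j)\in\mathcal E'$ for some $i$. Fix an integer $K\ge 1$ and a time window $[t_0,t_f]$, $0\le t_0<t_f$. Each broadcaster $i\in\mathcal B$ posts stories at the points of a temporal point process on $(0,\infty)$ with deterministic intensity function $\mu_i\ge 0$ (an inhomogeneous Poisson process), and each $j\in V'$ receives stories, through the links already in the network, at the points of such a process with intensity function $\gamma_{j}$; all intensities are integrable on bounded intervals. For each $j\in V'$, the latter process and the processes of the broadcasters $i$ with $(i,j)\in\mathcal E'$ are mutually independent. For $\mathcal S\subseteq\mathcal E'$, when the links $\mathcal S$ are added the feed of $j$ receives the stories that it already received and those of all $i$ with $(i,j)\in\mathcal S$; it is empty at time $0$ and ordered in inverse chronological order. Let $r_{\mathcal S}(t,i,j)$ be the number of stories posted by $i$ that are among the top $K$ positions of this feed at time $t$. The average top-$K$ visibility is $$F(\mathcal S)=\sum_{j\in V'}\ \sum_{i:(i,j)\in\mathcal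 S}\mathbb E\Big[\int_{t_0}^{t_f} r_{\mathcal S}(t,i,j)\,dt\Big],\qquad \mathcal S\subseteq\mathcal E'.$$ For a set function $F$ on the subsets of $\mathcal E'$ write $\rho_e(\mathcal A)=F(\mathcal A\cup\{e\})-F(\mathcal A)$. $F$ is $\alpha$-submodular if $\rho_e(\mathcal A)\ge(1-\alpha)\rho_e(\mathcal C)$ for all $e\in\mathcal E'$ and $\mathcal A\subseteq\mathcal C\subseteq\mathcal E'$; its generalized curvature is the smallest $\alpha\le 1$ for which $F$ is $\alpha$-submodular. **Theorem.** Suppose that * for every $\mathcal S\subseteq\mathcal E'$ and $j\in V'$ the feed intensity $\lambda(t)=\gamma_j(t)+\sum_{i:(i,j)\in\mathcal S}\mu_i(t)$ is $\xi$-bounded, i.e. $\sup_{(0,t_f)}\lambda<\infty$ and $\sup_{(0,t_f)}\lambda\le\xi\,\inf_{(0,t_f)}\lambda$; * there is $c_2>0$ with $\gamma_j(t)\ge c_2$ for all $j\in V'$, $t\in(t_0,t_f)$; * for some $\zeta>4e^{7/4}$ and all $j\in V'$, $\int_0^{t_0}\gamma_j(x)\,dx\ \ge\ K-1+\zeta\sqrt{K-1}$.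 Then $F$ is $\alpha^*$-submodular with $$\alpha^*=1-\frac{1}{\xi\left(\dfrac{6.154\,e^2}{1-4e^{7/4}/\zeta}\,\xi\sqrt K+1\right)} .$$ Consequently the generalized curvature $\alpha$ of $F$, which exists as soon as some marginal gain $\rho_e(\mathcal A)$ with $e\in\mathcal E'$, $\mathcal A\subseteq\mathcal E'$ is nonzero, satisfies $\alpha\le\alpha^*$. -/

import Mathlib

open MeasureTheory ProbabilityTheory Set

namespace LinkRecommendation

/-! ### Set functions -/

/-- The marginal gain `F (A ∪ {v}) - F A`. -/
def marginal {α : Type*} [DecidableEq α] (F : Finset α → ℝ) (v : α) (A : Finset α) : ℝ :=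
  F (insert v A) - F A

/-- `F` is `a`-submodular on the ground set `W`: for every `v ∈ W` and `A ⊆ C ⊆ W`, the marginal
gain of `v` at `A` is at least `(1 - a)` times the marginal gain of `v` at `C`. -/
def IsAlphaSubmodular {α : Type*} [DecidableEq α] (W : Finset α) (F : Finset α → ℝ)
    (a : ℝ) : Prop :=
  ∀ v ∈ W, ∀ A C : Finset α, A ⊆ C → C ⊆ W → (1 - a) * marginal F v C ≤ marginal F v A

/-- `a` is the generalized curvature of `F` on the ground set `W`: the smallest real number `≤ 1`
for which `F` is `a`-submodular. -/
def IsGeneralizedCurvature {α : Type*} [DecidableEq α] (W : Finset α) (F : Finset α → ℝ)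
    (a : ℝ) : Prop :=
  IsLeast {b : ℝ | b ≤ 1 ∧ IsAlphaSubmodular W F b} a

/-! ### Point processes on `(0, ∞)` -/

/-- The number of points of `S` in the interval `(a, b]`. -/
noncomputable def numPosts (S : Set ℝ) (a b : ℝ) : ℕ := (S ∩ Ioc a b).ncard

/-- The random set of times `T` is a temporal point process on `(0, ∞)` with (deterministic)
intensity function `lam`, that is, an inhomogeneous Poisson process: its realizations are locally
finite, the number of points in `(a, b]` has the Poisson law of mean `∫ x in a..b, lam x`, and the
numbers of points in successive intervals are independent. -/
structure IsPoissonProcess {Ω : Type*} [MeasurableSpace Ω] (P : Measure Ω)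
    (T : Ω → Set ℝ) (lam : ℝ → ℝ) : Prop where
  pos : ∀ ω, T ω ⊆ Ioi 0
  locallyFinite : ∀ ω b, (T ω ∩ Ioc 0 b).Finite
  intensity_nonneg : ∀ t, 0 < t → 0 ≤ lam t
  intensity_integrable : ∀ b, 0 ≤ b → IntervalIntegrable lam volume 0 b
  measurable_numPosts : ∀ a b, Measurable fun ω => numPosts (T ω) a b
  law : ∀ a b, 0 ≤ a → a ≤ b →
    P.map (fun ω => numPosts (T ω) a b) = poissonMeasure (∫ x in a..b, lam x).toNNReal
  indep : ∀ t : ℕ → ℝ, 0 ≤ t 0 → Monotone t →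
    iIndepFun (fun (n : ℕ) ω => numPosts (T ω) (t n) (t (n + 1))) P

/-- Mutual independence of a family of point processes, each one being described by its numbers of
points in all intervals. -/
def IndepProcesses {Ω ι : Type*} [MeasurableSpace Ω] (P : Measure Ω) (T : ι → Ω → Set ℝ) : Prop :=
  iIndepFun (fun (s : ι) ω (I : ℝ × ℝ) => numPosts (T s ω) I.1 I.2) P

/-- `sup f ≤ ξ · inf f` over `I`, the supremum being finite. -/
def XiBounded (ξ : ℝ) (I : Set ℝ) (f : ℝ → ℝ) : Prop :=
  BddAbove (f '' I) ∧ sSup (f '' I) ≤ ξ * sInf (f '' I)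

/-! ### Visibility

Users are the elements of `V`; a link `(i, j) : V × V` means that `j` follows `i`. `B` is the set
of broadcasters, `post i` is the random set of times at which `i` posts, and `feed j` is the random
set of times at which `j` receives a story through the links that are already in the network.
`S` is a set of new links. -/

section Visibility

variable {V Ω : Type*} [DecidableEq V]

/-- The users that gain a broadcaster through the candidate links `E'`. -/
def followers (E' : Finset (V × V)) : Finset V := E'.image Prod.snd

/-- The broadcasters in `B` that `j` follows through the links `S`. -/
def sources (B : Finset V) (S : Finset (V × V)) (j : V) : Finset V := {i ∈ B | (i, j) ∈ S}

/-- The intensity with which `j` receives stories once the links `S` have been added. -/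
def feedIntensity (B : Finset V) (μ γ : V → ℝ → ℝ) (S : Finset (V × V)) (j : V) (t : ℝ) : ℝ :=
  γ j t + ∑ i ∈ sources B S j, μ i t

/-- The number of stories that `j` receives during `(τ, t]` once the links `S` have been added. -/
noncomputable def received (B : Finset V) (post feed : V → Ω → Set ℝ) (S : Finset (V × V)) (j : V)
    (ω : Ω) (τ t : ℝ) : ℕ :=
  numPosts (feed j ω) τ t + ∑ i ∈ sources B S j, numPosts (post i ω) τ t

/-- `r(t, i, j)`: the number of stories posted by `i` that are among the top `K` positions of the
feed of `j` at time `t`. The feed is in inverse chronological order, so that a story posted at time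
`τ` is among the top `K` when fewer than `K` stories arrived after it. -/
noncomputable def topCount (K : ℕ) (B : Finset V) (post feed : V → Ω → Set ℝ)
    (S : Finset (V × V)) (i j : V) (t : ℝ) (ω : Ω) : ℕ :=
  {τ ∈ post i ω ∩ Ioc 0 t | received B post feed S j ω τ t < K}.ncard

/-- The expected top `K` visibility of broadcaster `i` with respect to `j` over `[t₀, tf]`. -/
noncomputable def edgeVisibility [MeasurableSpace Ω] (P : Measure Ω) (K : ℕ) (t₀ tf : ℝ)
    (B : Finset V) (post feed : V → Ω → Set ℝ) (S : Finset (V × V)) (i j : V) : ℝ :=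
  ∫ ω, (∫ t in t₀..tf, (topCount K B post feed S i j t ω : ℝ)) ∂P

/-- The average top `K` visibility `F(S)` of the broadcasters with respect to the followers
induced by the links `S ⊆ E'`. -/
noncomputable def visibility [MeasurableSpace Ω] (P : Measure Ω) (K : ℕ) (t₀ tf : ℝ)
    (B : Finset V) (E' : Finset (V × V)) (post feed : V → Ω → Set ℝ) (S : Finset (V × V)) : ℝ :=
  ∑ j ∈ followers E', ∑ i ∈ sources B S j, edgeVisibility P K t₀ tf B post feed S i j

end Visibility

/-- The bound `α* = 1 - 1 / (ξ (6.154 e² / (1 - 4 e^{7/4} / ζ) · ξ √K + 1))`. -/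
noncomputable def curvatureBound (ξ ζ : ℝ) (K : ℕ) : ℝ :=
  1 - 1 / (ξ * (6.154 * Real.exp 2 / (1 - 4 * Real.exp (7 / 4) / ζ) * ξ * √(K : ℝ) + 1))

end LinkRecommendation

open LinkRecommendation

/-!
The expected visibility is first expressed through the intensities. Cut `(0, t]` into cells. The
number of posts of `i` in a cell is independent of the number of stories that arrive after the cell,
and the latter is a Poisson variable, as a sum of independent ones. Refining the cells, which
pathwise recovers the top count (`tendsto_sum_cells_countTop`), gives
`E[r(t, i, j)] = ∫_0^t μ_i(x) Q(∫_x^t λ) dx`, where `λ` is the intensity of the feed of `j` and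
`Q(m)` is the probability that a Poisson variable of mean `m` is less than `K`
(`integral_countTop`). A Fubini argument then turns `F` into a sum of time integrals of such terms
(`sum_edgeVisibility`), and a new link `(v, j)` changes the feed of `j` only
(`marginal_visibility`). It therefore suffices to compare marginal gains for a fixed follower and a
fixed time.

Write `ν = μ_v`, and let `λ` and `λ'` be the feed intensities for `A ⊆ C`. For an integrable
intensity `λ` the substitution `u = ∫_x^t λ` gives `∫_0^t λ(x) Q(∫_x^t λ) dx = ∫_0^{∫_0^t λ} Q`
(`integral_mul_comp_integral`). Hence the gain is `δ + D(γ)`: here `δ` is the integral of `Q` over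
`[∫ λ, ∫ λ + ∫ ν]`, and `D(f)` is the decrease of `∫_0^t f(x) Q(∫_x^t λ) dx` when `ν` is added to
`λ`. The same substitution shows that `δ + D(λ)` is equal to `∫_0^t ν(x) Q(∫_x^t (λ + ν)) dx`.
As `Q` is nonnegative and antitone, both `δ` and this last integral are smaller for `λ'` than for
`λ`. With `g = inf γ ≤ c = inf λ'`, the bounds `g ≤ γ ≤ ξ g` and `c ≤ λ' ≤ ξ c` give
`c D'(γ) ≤ ξ g D'(λ') ≤ ξ g (δ + D(λ)) ≤ ξ (g δ + ξ c D(γ))`, because `λ ≤ λ' ≤ ξ c`. Thus the gain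
at `C` is at most `ξ² + ξ` times the gain at `A` (`broadcasterGain_le`). This is stronger than the
claim: the factor `6.154 e² √K / (1 - 4 e^{7/4} / ζ)` in the bound is at least one
(`le_curvatureBound`).

The generalized curvature exists as soon as a marginal gain is nonzero, hence positive: the set of
admissible parameters is closed, it contains the bound, and it is bounded below by zero.
-/

namespace LinkRecommendation

open Filter Topology

/-! ### The lower tail of the Poisson law -/

/-- The probability `e⁻ᵐ ∑_{k < K} mᵏ / k!` that a Poisson variable of mean `m` is less than `K`,
as a function of the real variable `m`. -/
noncomputable def poissonBelow (K : ℕ) (m : ℝ) : ℝ :=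
  Real.exp (-m) * ∑ k ∈ Finset.range K, m ^ k / (k.factorial : ℝ)

lemma continuous_poissonBelow (K : ℕ) : Continuous (poissonBelow K) := by
  unfold poissonBelow; fun_prop

lemma poissonBelow_nonneg (K : ℕ) {m : ℝ} (hm : 0 ≤ m) : 0 ≤ poissonBelow K m := by
  unfold poissonBelow; positivity

lemma poissonMeasure_real_Iio (K : ℕ) (r : NNReal) :
    (poissonMeasure r).real {n | n < K} = poissonBelow K r := by
  have h : {n : ℕ | n < K} = (Finset.range K : Set ℕ) := by ext; simp
  rw [h, ← sum_measureReal_singleton, poissonBelow, Finset.mul_sum]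
  simp [poissonMeasure_real_singleton, mul_div_assoc]

lemma poissonBelow_le_one (K : ℕ) {m : ℝ} (hm : 0 ≤ m) : poissonBelow K m ≤ 1 := by
  lift m to NNReal using hm
  rw [← poissonMeasure_real_Iio]
  exact measureReal_le_one

lemma hasDerivAt_poissonBelow (K : ℕ) (m : ℝ) :
    HasDerivAt (poissonBelow (K + 1)) (-(Real.exp (-m) * (m ^ K / (K.factorial : ℝ)))) m := by
  have he : HasDerivAt (fun m : ℝ => Real.exp (-m)) (-Real.exp (-m)) m := by
    simpa using (hasDerivAt_neg m).exp
  induction K with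
  | zero =>
    have : poissonBelow (0 + 1) = fun m => Real.exp (-m) := by ext; simp [poissonBelow]
    rw [this]
    simpa using he
  | succ K ih =>
    have hs : poissonBelow (K + 1 + 1) = fun m => poissonBelow (K + 1) m +
        Real.exp (-m) * (m ^ (K + 1) / ((K + 1).factorial : ℝ)) := by
      ext x
      rw [poissonBelow, Finset.sum_range_succ, mul_add, ← poissonBelow]
    rw [hs]
    have hp : HasDerivAt (fun m : ℝ => m ^ (K + 1) / ((K + 1).factorial : ℝ))
        (m ^ K / (K.factorial : ℝ)) m := by
      convert! (hasDerivAt_pow (K + 1) m).div_const ((K + 1).factorial : ℝ) using 1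
      rw [Nat.factorial_succ]
      push_cast
      field_simp
    convert! ih.add (he.mul hp) using 1
    ring

lemma antitoneOn_poissonBelow (K : ℕ) : AntitoneOn (poissonBelow K) (Ici 0) := by
  cases K with
  | zero => intro x _ y _ _; simp [poissonBelow]
  | succ K =>
    refine antitoneOn_of_deriv_nonpos (convex_Ici 0) (continuous_poissonBelow _).continuousOn
      (fun x _ => (hasDerivAt_poissonBelow K x).differentiableAt.differentiableWithinAt) ?_
    intro x hx
    rw [interior_Ici, mem_Ioi] at hx
    rw [(hasDerivAt_poissonBelow K x).deriv]
    have : 0 ≤ Real.exp (-x) * (x ^ K / (K.factorial : ℝ)) := by positivity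
    linarith

/-! ### Change of variables along an integrable intensity -/

lemma _root_.LipschitzOnWith.comp_absolutelyContinuousOnInterval {X Y : Type*}
    [PseudoMetricSpace X] [PseudoMetricSpace Y] {g : X → Y} {f : ℝ → X} {a b : ℝ} {s : Set X}
    {C : NNReal} (hg : LipschitzOnWith C g s) (hf : AbsolutelyContinuousOnInterval f a b)
    (hs : MapsTo f (uIcc a b) s) : AbsolutelyContinuousOnInterval (g ∘ f) a b := by
  rw [absolutelyContinuousOnInterval_iff] at hf ⊢
  intro ε hε
  obtain ⟨δ, hδ, h⟩ := hf (ε / (C + 1)) (by positivity)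
  refine ⟨δ, hδ, fun E hE hlen => ?_⟩
  have h1 := h E hE hlen
  calc _ ≤ ∑ i ∈ Finset.range E.1, C * dist (f (E.2 i).1) (f (E.2 i).2) := by
        refine Finset.sum_le_sum fun i hi => hg.dist_le_mul _ (hs ?_) _ (hs ?_)
        · exact (hE.1 i hi).1
        · exact (hE.1 i hi).2
    _ = C * ∑ i ∈ Finset.range E.1, dist (f (E.2 i).1) (f (E.2 i).2) := by rw [Finset.mul_sum]
    _ ≤ (C + 1) * ∑ i ∈ Finset.range E.1, dist (f (E.2 i).1) (f (E.2 i).2) := by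
        gcongr; simp
    _ < (C + 1) * (ε / (C + 1)) := by gcongr
    _ = ε := by field_simp

lemma continuousOn_integral_left {lam : ℝ → ℝ} {t : ℝ} (h : IntervalIntegrable lam volume 0 t) :
    ContinuousOn (fun x => ∫ y in x..t, lam y) (uIcc 0 t) := by
  simp only [intervalIntegral.integral_symm t]
  exact (intervalIntegral.continuousOn_primitive_interval' h right_mem_uIcc).neg

/-- The substitution `u = ∫_x^t lam` for an intensity `lam` that is merely integrable. -/
lemma integral_mul_comp_integral {lam Q : ℝ → ℝ} {t : ℝ} (hQ : Continuous Q)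
    (h : IntervalIntegrable lam volume 0 t) :
    ∫ x in (0 : ℝ)..t, lam x * Q (∫ y in x..t, lam y) =
      ∫ u in (0 : ℝ)..∫ y in (0 : ℝ)..t, lam y, Q u := by
  set Φ : ℝ → ℝ := fun u => ∫ v in (0 : ℝ)..u, Q v
  set L : ℝ → ℝ := fun x => (∫ y in (0 : ℝ)..t, lam y) - ∫ y in (0 : ℝ)..x, lam y
  have hΦ : ∀ u, HasDerivAt Φ (Q u) u := fun u => hQ.integral_hasStrictDerivAt 0 u |>.hasDerivAt
  have hacL : AbsolutelyContinuousOnInterval L 0 t := by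
    have h1 := h.absolutelyContinuousOnInterval_intervalIntegral (c := 0) left_mem_uIcc
    have h2 : AbsolutelyContinuousOnInterval (fun _ : ℝ => ∫ y in (0 : ℝ)..t, lam y) 0 t :=
      (LipschitzWith.const _).lipschitzOnWith.absolutelyContinuousOnInterval
    exact h2.sub h1
  have hac : AbsolutelyContinuousOnInterval (Φ ∘ L) 0 t := by
    have hcomp : IsCompact (L '' uIcc 0 t) := isCompact_uIcc.image_of_continuousOn hacL.continuousOn
    obtain ⟨r, hr⟩ := hcomp.isBounded.subset_closedBall 0
    have hΦC : ContDiff ℝ 1 Φ := by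
      rw [contDiff_one_iff_deriv]
      refine ⟨fun u => (hΦ u).differentiableAt, ?_⟩
      have : deriv Φ = Q := funext fun u => (hΦ u).deriv
      rwa [this]
    obtain ⟨C, hC⟩ := hΦC.contDiffOn.exists_lipschitzOnWith one_ne_zero
      (convex_closedBall (0 : ℝ) r) (isCompact_closedBall 0 r)
    exact hC.comp_absolutelyContinuousOnInterval hacL fun x hx => hr (mem_image_of_mem _ hx)
  have key := hac.integral_deriv_eq_sub
  have hL : ∀ x ∈ uIcc 0 t, L x = ∫ y in x..t, lam y := by
    intro x hx
    have h1 : IntervalIntegrable lam volume 0 x := h.mono_set (uIcc_subset_uIcc_left hx)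
    exact intervalIntegral.integral_interval_sub_left h h1
  have hae : ∀ᵐ x, x ∈ uIcc 0 t → deriv (Φ ∘ L) x = -(lam x * Q (∫ y in x..t, lam y)) := by
    filter_upwards [h.ae_hasDerivAt_integral] with x hx hmem
    have hd := hx hmem 0 left_mem_uIcc
    have hdL : HasDerivAt L (-lam x) x := by simpa using hd.const_sub (∫ y in (0 : ℝ)..t, lam y)
    rw [((hΦ (L x)).comp x hdL).deriv, hL x hmem]
    ring
  have hcongr : ∫ x in (0 : ℝ)..t, deriv (Φ ∘ L) x =
      ∫ x in (0 : ℝ)..t, -(lam x * Q (∫ y in x..t, lam y)) := by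
    refine intervalIntegral.integral_congr_ae ?_
    filter_upwards [hae] with x hx hmem using hx (uIoc_subset_uIcc hmem)
  rw [hcongr, intervalIntegral.integral_neg] at key
  have h0 : (Φ ∘ L) t = 0 := by simp [Φ, L]
  have h1 : (Φ ∘ L) 0 = ∫ u in (0 : ℝ)..∫ y in (0 : ℝ)..t, lam y, Q u := by simp [Φ, L]
  rw [h0, h1] at key
  linarith

/-! ### Expected top counts and the marginal gain of one broadcaster -/

/-- The expected number of stories among the top `K` positions at time `t` that stem from a
broadcaster of intensity `f`, in a feed of total intensity `lam`: a story posted at time `x` is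
among the top `K` with the probability that fewer than `K` stories arrive during `(x, t]`. -/
noncomputable def expectedTop (K : ℕ) (lam f : ℝ → ℝ) (t : ℝ) : ℝ :=
  ∫ x in (0 : ℝ)..t, f x * poissonBelow K (∫ y in x..t, lam y)

section

variable {K : ℕ} {t : ℝ} {lam lam' f g : ℝ → ℝ}

lemma intervalIntegrable_mul_poissonBelow (K : ℕ) (hlam : IntervalIntegrable lam volume 0 t)
    (hf : IntervalIntegrable f volume 0 t) :
    IntervalIntegrable (fun x => f x * poissonBelow K (∫ y in x..t, lam y)) volume 0 t :=
  hf.mul_continuousOn ((continuous_poissonBelow K).comp_continuousOn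
    (continuousOn_integral_left hlam))

lemma expectedTop_add (hlam : IntervalIntegrable lam volume 0 t)
    (hf : IntervalIntegrable f volume 0 t) (hg : IntervalIntegrable g volume 0 t) :
    expectedTop K lam (fun x => f x + g x) t = expectedTop K lam f t + expectedTop K lam g t := by
  simp only [expectedTop, add_mul]
  exact intervalIntegral.integral_add (intervalIntegrable_mul_poissonBelow K hlam hf)
    (intervalIntegrable_mul_poissonBelow K hlam hg)

/-- The total expected top count is `E[min (N, K)]`, for a Poisson variable `N` of mean
`∫_0^t lam`. -/
lemma expectedTop_self (hlam : IntervalIntegrable lam volume 0 t) :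
    expectedTop K lam lam t = ∫ u in (0 : ℝ)..∫ y in (0 : ℝ)..t, lam y, poissonBelow K u :=
  integral_mul_comp_integral (continuous_poissonBelow K) hlam

lemma integral_nonneg_of_Ioo {a b : ℝ} (hab : a ≤ b) (hf : IntervalIntegrable f volume a b)
    (h : ∀ x ∈ Ioo a b, 0 ≤ f x) : 0 ≤ ∫ y in a..b, f y := by
  simpa using intervalIntegral.integral_mono_on_of_le_Ioo hab
    (intervalIntegrable_const (c := (0 : ℝ)) (μ := volume)) hf h

lemma poissonBelow_integral_antitone (hlam : IntervalIntegrable lam volume 0 t)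
    (hlam' : IntervalIntegrable lam' volume 0 t) (h0 : ∀ x ∈ Ioo 0 t, 0 ≤ lam x)
    (hle : ∀ x ∈ Ioo 0 t, lam x ≤ lam' x) {x : ℝ} (hx : x ∈ Icc 0 t) :
    poissonBelow K (∫ y in x..t, lam' y) ≤ poissonBelow K (∫ y in x..t, lam y) := by
  have hsub : uIcc x t ⊆ uIcc 0 t := by
    rw [uIcc_of_le hx.2, uIcc_of_le (hx.1.trans hx.2)]
    exact Icc_subset_Icc_left hx.1
  have h1 : 0 ≤ ∫ y in x..t, lam y := integral_nonneg_of_Ioo hx.2 (hlam.mono_set hsub)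
    fun y hy => h0 y ⟨hx.1.trans_lt hy.1, hy.2⟩
  have h2 := intervalIntegral.integral_mono_on_of_le_Ioo hx.2 (hlam.mono_set hsub)
    (hlam'.mono_set hsub) (fun y hy => hle y ⟨hx.1.trans_lt hy.1, hy.2⟩)
  exact antitoneOn_poissonBelow K h1 (h1.trans h2) h2

/-- The reduction of the expected top counts caused by an increase of the total intensity is
monotone in the intensity of the broadcaster. -/
lemma expectedTop_sub_mono (ht : 0 ≤ t) (hlam : IntervalIntegrable lam volume 0 t)
    (hlam' : IntervalIntegrable lam' volume 0 t) (h0 : ∀ x ∈ Ioo 0 t, 0 ≤ lam x)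
    (hle : ∀ x ∈ Ioo 0 t, lam x ≤ lam' x) (hf : IntervalIntegrable f volume 0 t)
    (hg : IntervalIntegrable g volume 0 t) {p q : ℝ} (hfg : ∀ x ∈ Ioo 0 t, p * f x ≤ q * g x) :
    p * (expectedTop K lam f t - expectedTop K lam' f t) ≤
      q * (expectedTop K lam g t - expectedTop K lam' g t) := by
  have hi := fun {l h} => intervalIntegrable_mul_poissonBelow (t := t) (lam := l) (f := h) K
  simp only [expectedTop]
  rw [← intervalIntegral.integral_sub (hi hlam hf) (hi hlam' hf),
    ← intervalIntegral.integral_sub (hi hlam hg) (hi hlam' hg),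
    ← intervalIntegral.integral_const_mul, ← intervalIntegral.integral_const_mul]
  refine intervalIntegral.integral_mono_on_of_le_Ioo ht
    (((hi hlam hf).sub (hi hlam' hf)).const_mul p) (((hi hlam hg).sub (hi hlam' hg)).const_mul q) ?_
  intro x hx
  have h1 := poissonBelow_integral_antitone (K := K) hlam hlam' h0 hle (Ioo_subset_Icc_self hx)
  have h2 := mul_le_mul_of_nonneg_right (hfg x hx) (sub_nonneg.2 h1)
  linarith

lemma expectedTop_antitone (ht : 0 ≤ t) (hlam : IntervalIntegrable lam volume 0 t)
    (hlam' : IntervalIntegrable lam' volume 0 t) (h0 : ∀ x ∈ Ioo 0 t, 0 ≤ lam x)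
    (hle : ∀ x ∈ Ioo 0 t, lam x ≤ lam' x) (hf : IntervalIntegrable f volume 0 t)
    (hf0 : ∀ x ∈ Ioo 0 t, 0 ≤ f x) : expectedTop K lam' f t ≤ expectedTop K lam f t := by
  have := expectedTop_sub_mono (K := K) (p := 0) (q := 1) ht hlam hlam' h0 hle hf hf
    (fun x hx => by simpa using hf0 x hx)
  linarith

end

/-- The gain, at time `t`, of a broadcaster of intensity `ν` that is added to a feed of total
intensity `lam`, of which `γ` does not count towards the visibility. -/
noncomputable def broadcasterGain (K : ℕ) (γ lam ν : ℝ → ℝ) (t : ℝ) : ℝ :=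
  expectedTop K (fun x => lam x + ν x) (fun x => lam x + ν x - γ x) t -
    expectedTop K lam (fun x => lam x - γ x) t

section

variable {K : ℕ} {t : ℝ} {γ lam lam' ν : ℝ → ℝ}

/-- The gain splits into the increase of the expected length of the top of the feed and the
number of the stories of intensity `γ` that are pushed out of it. -/
lemma broadcasterGain_eq (hγ : IntervalIntegrable γ volume 0 t)
    (hlam : IntervalIntegrable lam volume 0 t) (hν : IntervalIntegrable ν volume 0 t) :
    broadcasterGain K γ lam ν t =
      (∫ u in (∫ y in (0 : ℝ)..t, lam y)..(∫ y in (0 : ℝ)..t, lam y) + ∫ y in (0 : ℝ)..t, ν y,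
        poissonBelow K u) +
      (expectedTop K lam γ t - expectedTop K (fun x => lam x + ν x) γ t) := by
  have hs : IntervalIntegrable (fun x => lam x + ν x) volume 0 t := hlam.add hν
  have h1 := expectedTop_add (K := K) hlam (hlam.sub hγ) hγ
  have h2 := expectedTop_add (K := K) hs (hs.sub hγ) hγ
  simp only [sub_add_cancel] at h1 h2
  rw [expectedTop_self hlam] at h1
  rw [expectedTop_self hs, intervalIntegral.integral_add hlam hν] at h2
  have hq : ∀ a b, IntervalIntegrable (poissonBelow K) volume a b :=
    fun a b => (continuous_poissonBelow K).intervalIntegrable a b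
  rw [← intervalIntegral.integral_interval_sub_left (hq 0 _) (hq 0 _), h1, h2, broadcasterGain]
  ring

lemma broadcasterGain_nonneg (ht : 0 ≤ t) (hγ : IntervalIntegrable γ volume 0 t)
    (hlam : IntervalIntegrable lam volume 0 t) (hν : IntervalIntegrable ν volume 0 t)
    (hγ0 : ∀ x ∈ Ioo 0 t, 0 ≤ γ x) (hγlam : ∀ x ∈ Ioo 0 t, γ x ≤ lam x)
    (hν0 : ∀ x ∈ Ioo 0 t, 0 ≤ ν x) : 0 ≤ broadcasterGain K γ lam ν t := by
  have hlam0 : ∀ x ∈ Ioo 0 t, 0 ≤ lam x := fun x hx => (hγ0 x hx).trans (hγlam x hx)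
  rw [broadcasterGain_eq hγ hlam hν]
  have h1 := expectedTop_antitone (K := K) ht hlam (hlam.add hν) hlam0
    (fun x hx => by simpa using hν0 x hx) hγ hγ0
  have h2 := intervalIntegral.integral_nonneg (μ := volume) (f := poissonBelow K)
    (a := ∫ y in (0 : ℝ)..t, lam y) (le_add_of_nonneg_right (integral_nonneg_of_Ioo ht hν hν0))
    (fun u hu => poissonBelow_nonneg K ((integral_nonneg_of_Ioo ht hlam hlam0).trans hu.1))
  linarith

/-- The gain in a feed of larger intensity `lam'` is at most `ξ ^ 2 + ξ` times the gain in a feed of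
intensity `lam`, when `γ` and `lam'` are within a factor `ξ` of the constants `g` and `c`.

The displacement of `γ` is compared with that of the total intensity, for which gain plus
displacement is exactly the expected top count of `ν`; this one is smaller in the larger feed. -/
lemma broadcasterGain_le {ξ g c : ℝ} (ht : 0 ≤ t) (hγ : IntervalIntegrable γ volume 0 t)
    (hlam : IntervalIntegrable lam volume 0 t) (hlam' : IntervalIntegrable lam' volume 0 t)
    (hν : IntervalIntegrable ν volume 0 t) (hg : 0 < g) (hgc : g ≤ c) (hξ : 1 ≤ ξ)
    (hgγ : ∀ x ∈ Ioo 0 t, g ≤ γ x) (hγg : ∀ x ∈ Ioo 0 t, γ x ≤ ξ * g)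
    (hclam : ∀ x ∈ Ioo 0 t, c ≤ lam' x) (hlamc : ∀ x ∈ Ioo 0 t, lam' x ≤ ξ * c)
    (hγlam : ∀ x ∈ Ioo 0 t, γ x ≤ lam x) (hle : ∀ x ∈ Ioo 0 t, lam x ≤ lam' x)
    (hν0 : ∀ x ∈ Ioo 0 t, 0 ≤ ν x) :
    broadcasterGain K γ lam' ν t ≤ (ξ ^ 2 + ξ) * broadcasterGain K γ lam ν t := by
  have hc : 0 < c := hg.trans_le hgc
  have hξ0 : 0 < ξ := one_pos.trans_le hξ
  have hlam0 : ∀ x ∈ Ioo 0 t, 0 ≤ lam x :=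
    fun x hx => hg.le.trans ((hgγ x hx).trans (hγlam x hx))
  have hlam0' : ∀ x ∈ Ioo 0 t, 0 ≤ lam' x := fun x hx => (hlam0 x hx).trans (hle x hx)
  have hs : IntervalIntegrable (fun x => lam x + ν x) volume 0 t := hlam.add hν
  have hs' : IntervalIntegrable (fun x => lam' x + ν x) volume 0 t := hlam'.add hν
  have hls : ∀ x ∈ Ioo 0 t, lam x ≤ lam x + ν x := fun x hx => by linarith [hν0 x hx]
  have hls' : ∀ x ∈ Ioo 0 t, lam' x ≤ lam' x + ν x := fun x hx => by linarith [hν0 x hx]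
  -- The increases `δ`, `δ'` of the expected length of the top of the feed: `poissonBelow K` is
  -- antitone, so that the increase is smaller in the larger feed.
  have hq : ∀ a b, IntervalIntegrable (poissonBelow K) volume a b :=
    fun a b => (continuous_poissonBelow K).intervalIntegrable a b
  have hν1 := integral_nonneg_of_Ioo ht hν hν0
  have hlam1 := integral_nonneg_of_Ioo ht hlam hlam0
  have hlamle : ∫ y in (0 : ℝ)..t, lam y ≤ ∫ y in (0 : ℝ)..t, lam' y :=
    intervalIntegral.integral_mono_on_of_le_Ioo ht hlam hlam' hle
  have hδ : (∫ u in (∫ y in (0 : ℝ)..t, lam' y)..(∫ y in (0 : ℝ)..t, lam' y) +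
        ∫ y in (0 : ℝ)..t, ν y, poissonBelow K u) ≤
      ∫ u in (∫ y in (0 : ℝ)..t, lam y)..(∫ y in (0 : ℝ)..t, lam y) +
        ∫ y in (0 : ℝ)..t, ν y, poissonBelow K u := by
    have hshift : ∀ a b : ℝ, ∫ u in a..a + b, poissonBelow K u =
        ∫ u in (0 : ℝ)..b, poissonBelow K (a + u) := fun a b => by
      rw [intervalIntegral.integral_comp_add_left (poissonBelow K) a, add_zero]
    rw [hshift, hshift]
    refine intervalIntegral.integral_mono_on hν1
      (((continuous_poissonBelow K).comp (by fun_prop)).intervalIntegrable _ _)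
      (((continuous_poissonBelow K).comp (by fun_prop)).intervalIntegrable _ _) fun u hu => ?_
    exact antitoneOn_poissonBelow K (mem_Ici.2 (add_nonneg hlam1 hu.1))
      (mem_Ici.2 (add_nonneg (hlam1.trans hlamle) hu.1)) (by linarith)
  have hδ0 : 0 ≤ ∫ u in (∫ y in (0 : ℝ)..t, lam y)..(∫ y in (0 : ℝ)..t, lam y) +
        ∫ y in (0 : ℝ)..t, ν y, poissonBelow K u :=
    intervalIntegral.integral_nonneg (le_add_of_nonneg_right hν1)
      (fun u hu => poissonBelow_nonneg K (hlam1.trans hu.1))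
  have hδ0' : 0 ≤ ∫ u in (∫ y in (0 : ℝ)..t, lam' y)..(∫ y in (0 : ℝ)..t, lam' y) +
        ∫ y in (0 : ℝ)..t, ν y, poissonBelow K u :=
    intervalIntegral.integral_nonneg (le_add_of_nonneg_right hν1)
      (fun u hu => poissonBelow_nonneg K ((hlam1.trans hlamle).trans hu.1))
  -- The gain for which every story of the feed counts is the expected top count of `ν` itself.
  have hsplit : ∀ l : ℝ → ℝ, IntervalIntegrable l volume 0 t →
      (∫ u in (∫ y in (0 : ℝ)..t, l y)..(∫ y in (0 : ℝ)..t, l y) +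
        ∫ y in (0 : ℝ)..t, ν y, poissonBelow K u) +
      (expectedTop K l l t - expectedTop K (fun x => l x + ν x) l t) =
      expectedTop K (fun x => l x + ν x) ν t := fun l hl => by
    have hs : IntervalIntegrable (fun x => l x + ν x) volume 0 t := hl.add hν
    have h1 := expectedTop_add (K := K) hs hl hν
    rw [expectedTop_self hs, intervalIntegral.integral_add hl hν] at h1
    rw [← intervalIntegral.integral_interval_sub_left (hq 0 _) (hq 0 _), h1, expectedTop_self hl]
    ring
  have e1 := hsplit lam hlam
  have e2 := hsplit lam' hlam'
  have hν2 : expectedTop K (fun x => lam' x + ν x) ν t ≤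
      expectedTop K (fun x => lam x + ν x) ν t :=
    expectedTop_antitone ht hs hs' (fun x hx => (hlam0 x hx).trans (hls x hx))
      (fun x hx => by linarith [hle x hx]) hν hν0
  have hγ' : c * (expectedTop K lam' γ t - expectedTop K (fun x => lam' x + ν x) γ t) ≤
      (ξ * g) * (expectedTop K lam' lam' t - expectedTop K (fun x => lam' x + ν x) lam' t) :=
    expectedTop_sub_mono ht hlam' hs' hlam0' hls' hγ hlam' fun x hx => by
      have := mul_le_mul (hγg x hx) (hclam x hx) hc.le (by positivity)
      linarith
  have hγ1 : g * (expectedTop K lam lam t - expectedTop K (fun x => lam x + ν x) lam t) ≤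
      (ξ * c) * (expectedTop K lam γ t - expectedTop K (fun x => lam x + ν x) γ t) :=
    expectedTop_sub_mono ht hlam hs hlam0 hls hlam hγ fun x hx => by
      have := mul_le_mul (hgγ x hx) ((hle x hx).trans (hlamc x hx)) (hlam0 x hx)
        (hg.le.trans (hgγ x hx))
      linarith
  have hγ2 : 0 ≤ expectedTop K lam γ t - expectedTop K (fun x => lam x + ν x) γ t :=
    sub_nonneg.2 (expectedTop_antitone ht hlam hs hlam0 hls hγ
      fun x hx => hg.le.trans (hgγ x hx))
  rw [broadcasterGain_eq hγ hlam' hν, broadcasterGain_eq hγ hlam hν]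
  generalize (∫ u in (∫ y in (0 : ℝ)..t, lam' y)..(∫ y in (0 : ℝ)..t, lam' y) +
        ∫ y in (0 : ℝ)..t, ν y, poissonBelow K u) = δ' at *
  generalize (∫ u in (∫ y in (0 : ℝ)..t, lam y)..(∫ y in (0 : ℝ)..t, lam y) +
        ∫ y in (0 : ℝ)..t, ν y, poissonBelow K u) = δ at *
  generalize expectedTop K lam γ t - expectedTop K (fun x => lam x + ν x) γ t = G at *
  generalize expectedTop K lam' γ t - expectedTop K (fun x => lam' x + ν x) γ t = G' at *
  generalize expectedTop K lam lam t - expectedTop K (fun x => lam x + ν x) lam t = H at *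
  generalize expectedTop K lam' lam' t - expectedTop K (fun x => lam' x + ν x) lam' t = H' at *
  -- `c * G' ≤ ξ * g * H' ≤ ξ * g * (δ + H) ≤ ξ * (c * δ + ξ * c * G)`.
  have h1 : c * G' ≤ c * (ξ ^ 2 * G + ξ * δ) := by
    have h2 : (ξ * g) * H' ≤ (ξ * g) * (δ + H) := by
      apply mul_le_mul_of_nonneg_left _ (by positivity); linarith
    have h3 := mul_le_mul_of_nonneg_left hγ1 hξ0.le
    have h4 := mul_le_mul_of_nonneg_right hgc (mul_nonneg hξ0.le hδ0)
    nlinarith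
  have h2 := le_of_mul_le_mul_left h1 hc
  nlinarith [mul_le_mul_of_nonneg_right hξ hγ2, mul_nonneg hξ0.le hδ0,
    mul_nonneg (sub_nonneg.2 hξ) hδ0, mul_nonneg hξ0.le hγ2, mul_nonneg (sub_nonneg.2 hξ)
    (mul_nonneg hξ0.le hδ0)]

end

/-! ### Counting the points of locally finite sets -/

section

variable {S : Set ℝ}

lemma finite_inter_Ioc (hpos : S ⊆ Ioi 0) (hfin : ∀ b, (S ∩ Ioc 0 b).Finite) (a b : ℝ) :
    (S ∩ Ioc a b).Finite :=
  (hfin b).subset fun _ hx => ⟨hx.1, hpos hx.1, hx.2.2⟩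

lemma eventually_inter_Ioc_eq_empty (hfin : ∀ a b, (S ∩ Ioc a b).Finite) (a : ℝ) :
    ∀ᶠ c in 𝓝[≥] a, S ∩ Ioc a c = ∅ := by
  have h1 : ∀ᶠ c in 𝓝[≥] a, c < a + 1 :=
    mem_nhdsWithin_of_mem_nhds (Iio_mem_nhds (lt_add_one a))
  have h2 : ∀ᶠ c in 𝓝[≥] a, ∀ x ∈ S ∩ Ioc a (a + 1), c < x :=
    (eventually_all_finite (hfin a (a + 1))).2 fun x hx =>
      mem_nhdsWithin_of_mem_nhds (Iio_mem_nhds hx.2.1)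
  filter_upwards [h1, h2] with c hc h
  refine eq_empty_iff_forall_notMem.2 fun x hx => ?_
  exact (h x ⟨hx.1, hx.2.1, hx.2.2.trans hc.le⟩).not_ge hx.2.2

/-- The number of points in `(a, b]` is right-continuous in `a`. -/
lemma eventually_numPosts_left_eq (hfin : ∀ a b, (S ∩ Ioc a b).Finite) (a b : ℝ) :
    ∀ᶠ c in 𝓝[≥] a, numPosts S c b = numPosts S a b := by
  filter_upwards [eventually_inter_Ioc_eq_empty hfin a, self_mem_nhdsWithin] with c hc hac
  unfold numPosts
  congr 1
  ext x
  refine ⟨fun hx => ⟨hx.1, (mem_Ici.1 hac).trans_lt hx.2.1, hx.2.2⟩, fun hx => ⟨hx.1, ?_, hx.2.2⟩⟩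
  by_contra! h
  exact eq_empty_iff_forall_notMem.1 hc x ⟨hx.1, hx.2.1, h⟩

/-- If `S` has no point in `(b, c]`, the number of points in `(a, c]` is that in `(a, b]`. -/
lemma inter_Ioc_right_eq {a b c : ℝ} (hbc : b ≤ c) (h : S ∩ Ioc b c = ∅) :
    S ∩ Ioc a c = S ∩ Ioc a b := by
  ext x
  refine ⟨fun hx => ⟨hx.1, hx.2.1, ?_⟩, fun hx => ⟨hx.1, hx.2.1, hx.2.2.trans hbc⟩⟩
  by_contra! h'
  exact eq_empty_iff_forall_notMem.1 h x ⟨hx.1, h', hx.2.2⟩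

end

/-- The smallest multiple of the mesh `δ` that is at least `x`. -/
noncomputable def roundUp (δ x : ℝ) : ℝ := ⌈x / δ⌉ * δ

lemma le_roundUp {δ : ℝ} (hδ : 0 < δ) (x : ℝ) : x ≤ roundUp δ x := by
  rw [roundUp, ← div_le_iff₀ hδ]; exact Int.le_ceil _

lemma roundUp_lt {δ : ℝ} (hδ : 0 < δ) (x : ℝ) : roundUp δ x < x + δ := by
  have := mul_lt_mul_of_pos_right (Int.ceil_lt_add_one (x / δ)) hδ
  rwa [add_mul, one_mul, div_mul_cancel₀ _ hδ.ne'] at this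

lemma roundUp_eq {δ x : ℝ} (hδ : 0 < δ) {n : ℕ} (hx : x ∈ Ioc (n * δ) ((n + 1 : ℕ) * δ)) :
    roundUp δ x = (n + 1 : ℕ) * δ := by
  have : ⌈x / δ⌉ = ((n + 1 : ℕ) : ℤ) := by
    rw [Int.ceil_eq_iff, lt_div_iff₀ hδ, div_le_iff₀ hδ]
    push_cast
    refine ⟨by simpa using hx.1, by simpa using hx.2⟩
  rw [roundUp, this, Int.cast_natCast]

lemma tendsto_roundUp {t : ℝ} (ht : 0 < t) (x : ℝ) :
    Tendsto (fun n : ℕ => roundUp (t / (n + 1 : ℕ)) x) atTop (𝓝[≥] x) := by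
  have hδ : ∀ n : ℕ, 0 < t / (n + 1 : ℕ) := fun n => by positivity
  refine tendsto_nhdsWithin_iff.2 ⟨?_, .of_forall fun n => le_roundUp (hδ n) x⟩
  have h0 : Tendsto (fun n : ℕ => t / (n + 1 : ℕ)) atTop (𝓝 0) :=
    (tendsto_const_div_atTop_nhds_zero_nat t).comp (tendsto_add_atTop_nat 1)
  exact tendsto_of_tendsto_of_tendsto_of_le_of_le tendsto_const_nhds
    (by simpa using h0.const_add x) (fun n => le_roundUp (hδ n) x) fun n => (roundUp_lt (hδ n) x).le

/-- A sum over the points of `S` of a function of the rounded point is a sum over the cells. -/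
lemma sum_numPosts_mul_eq_finsum {S : Set ℝ} (hfin : ∀ a b, (S ∩ Ioc a b).Finite) {δ : ℝ}
    (hδ : 0 < δ) (f : ℝ → ℝ) (n : ℕ) :
    ∑ k ∈ Finset.range n, (numPosts S (k * δ) ((k + 1 : ℕ) * δ) : ℝ) * f ((k + 1 : ℕ) * δ) =
      ∑ᶠ τ ∈ S ∩ Ioc 0 (n * δ), f (roundUp δ τ) := by
  induction n with
  | zero => simp
  | succ n ih =>
    have hle : (n : ℝ) * δ ≤ (n + 1 : ℕ) * δ := by
      gcongr; simp
    have hun : S ∩ Ioc 0 ((n + 1 : ℕ) * δ) =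
        S ∩ Ioc 0 (n * δ) ∪ S ∩ Ioc (n * δ) ((n + 1 : ℕ) * δ) := by
      rw [← inter_union_distrib_left, Ioc_union_Ioc_eq_Ioc (by positivity) hle]
    have hdis : Disjoint (S ∩ Ioc 0 (n * δ)) (S ∩ Ioc (n * δ) ((n + 1 : ℕ) * δ)) :=
      (Ioc_disjoint_Ioc_of_le le_rfl).mono inter_subset_right inter_subset_right
    rw [Finset.sum_range_succ, ih, hun, finsum_mem_union hdis (hfin _ _) (hfin _ _)]
    congr 1
    rw [finsum_mem_congr rfl fun τ hτ => by rw [roundUp_eq hδ hτ.2],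
      finsum_mem_eq_finite_toFinset_sum _ (hfin _ _), Finset.sum_const, nsmul_eq_mul, numPosts,
      ncard_eq_toFinset_card _ (hfin _ _)]

/-! ### The top of a feed that is fed by several processes -/

/-- The number of points of `T s` in `(0, t]` that are followed by fewer than `K` points, in total,
of the processes `T r`, `r ∈ R`. -/
noncomputable def countTop {ι Ω : Type*} (K : ℕ) (T : ι → Ω → Set ℝ) (R : Finset ι) (s : ι) (t : ℝ)
    (ω : Ω) : ℕ :=
  {τ ∈ T s ω ∩ Ioc 0 t | ∑ r ∈ R, numPosts (T r ω) τ t < K}.ncard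

section

variable {ι Ω : Type*} {K : ℕ} {T : ι → Ω → Set ℝ} {R : Finset ι} {s : ι} {ω : Ω}

lemma countTop_le_numPosts (hfin : ∀ r a b, (T r ω ∩ Ioc a b).Finite) (t : ℝ) :
    countTop K T R s t ω ≤ numPosts (T s ω) 0 t :=
  ncard_le_ncard (sep_subset _ _) (hfin s 0 t)

/-- The top count is right-continuous in time. -/
lemma eventually_countTop_eq (hfin : ∀ r a b, (T r ω ∩ Ioc a b).Finite) (hs : s ∈ R) (t : ℝ) :
    ∀ᶠ c in 𝓝[≥] t, countTop K T R s c ω = countTop K T R s t ω := by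
  have h : ∀ᶠ c in 𝓝[≥] t, ∀ r ∈ R, T r ω ∩ Ioc t c = ∅ :=
    (eventually_all_finset R).2 fun r _ => eventually_inter_Ioc_eq_empty (hfin r) t
  filter_upwards [h, self_mem_nhdsWithin] with c hc htc
  unfold countTop
  rw [inter_Ioc_right_eq htc (hc s hs)]
  have : ∀ τ, ∑ r ∈ R, numPosts (T r ω) τ c = ∑ r ∈ R, numPosts (T r ω) τ t := fun τ =>
    Finset.sum_congr rfl fun r hr => by rw [numPosts, inter_Ioc_right_eq htc (hc r hr), numPosts]
  simp only [this]

/-- The top count is the limit of the counts in which the points that arrive in the same cell of the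
partition of `(0, t]` into `n + 1` cells are ignored. In those, each cell is counted under
a condition on later cells only. -/
lemma tendsto_sum_cells_countTop (hfin : ∀ r a b, (T r ω ∩ Ioc a b).Finite) {t : ℝ} (ht : 0 < t) :
    Tendsto (fun n : ℕ => ∑ k ∈ Finset.range (n + 1),
      (numPosts (T s ω) (k * (t / (n + 1 : ℕ))) ((k + 1 : ℕ) * (t / (n + 1 : ℕ))) : ℝ) *
        {m : ℕ | m < K}.indicator 1
          (∑ r ∈ R, numPosts (T r ω) ((k + 1 : ℕ) * (t / (n + 1 : ℕ))) t))
      atTop (𝓝 (countTop K T R s t ω)) := by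
  set ind : ℕ → ℝ := {m : ℕ | m < K}.indicator 1
  have hsum : ∀ n : ℕ, ∑ k ∈ Finset.range (n + 1),
      (numPosts (T s ω) (k * (t / (n + 1 : ℕ))) ((k + 1 : ℕ) * (t / (n + 1 : ℕ))) : ℝ) *
        ind (∑ r ∈ R, numPosts (T r ω) ((k + 1 : ℕ) * (t / (n + 1 : ℕ))) t) =
      ∑ τ ∈ (hfin s 0 t).toFinset,
        ind (∑ r ∈ R, numPosts (T r ω) (roundUp (t / (n + 1 : ℕ)) τ) t) := fun n => by
    rw [sum_numPosts_mul_eq_finsum (hfin s) (by positivity)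
      (fun x => ind (∑ r ∈ R, numPosts (T r ω) x t)), mul_div_cancel₀ t (by positivity),
      finsum_mem_eq_finite_toFinset_sum _ (hfin _ _ _)]
  have hlim : (countTop K T R s t ω : ℝ) =
      ∑ τ ∈ (hfin s 0 t).toFinset, ind (∑ r ∈ R, numPosts (T r ω) τ t) := by
    have : {τ ∈ T s ω ∩ Ioc 0 t | ∑ r ∈ R, numPosts (T r ω) τ t < K} =
        {τ ∈ (hfin s 0 t).toFinset | ∑ r ∈ R, numPosts (T r ω) τ t < K} := by
      ext; simp
    rw [countTop, this, ncard_coe_finset, Finset.card_filter]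
    push_cast
    refine Finset.sum_congr rfl fun τ _ => ?_
    simp [ind, indicator_apply]
  rw [hlim]
  simp only [hsum]
  refine tendsto_finsetSum _ fun τ _ => ?_
  have h : ∀ᶠ c in 𝓝[≥] τ, ∀ r ∈ R, numPosts (T r ω) c t = numPosts (T r ω) τ t :=
    (eventually_all_finset R).2 fun r _ => eventually_numPosts_left_eq (hfin r) τ t
  refine tendsto_const_nhds.congr' ?_
  filter_upwards [(tendsto_roundUp ht τ).eventually h] with n hn
  rw [Finset.sum_congr rfl hn]

end

/-! ### Moments and sums of Poisson variables -/

lemma hasSum_mean_poissonMeasure (r : NNReal) :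
    HasSum (fun n : ℕ => Real.exp (-r) * (r : ℝ) ^ n / (n.factorial : ℝ) * n) r := by
  have h := (hasSum_one_poissonMeasure r).mul_left (r : ℝ)
  rw [mul_one] at h
  rw [← hasSum_nat_add_iff' 1]
  simp only [Finset.range_one, Finset.sum_singleton, Nat.cast_zero, mul_zero, sub_zero]
  convert! h using 2 with n
  rw [Nat.factorial_succ]
  push_cast
  field_simp
  ring

lemma integrable_natCast_poissonMeasure (r : NNReal) :
    Integrable (fun n : ℕ => (n : ℝ)) (poissonMeasure r) := by
  rw [integrable_poissonMeasure_iff]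
  simpa using (hasSum_mean_poissonMeasure r).summable

lemma integral_natCast_poissonMeasure (r : NNReal) : ∫ n : ℕ, (n : ℝ) ∂poissonMeasure r = r := by
  rw [integral_poissonMeasure]
  exact (hasSum_mean_poissonMeasure r).tsum_eq

lemma poissonMeasure_zero : poissonMeasure 0 = Measure.dirac 0 := by
  refine Measure.ext_of_singleton fun n => ?_
  rw [poissonMeasure_singleton]
  cases n <;> simp

lemma _root_.ProbabilityTheory.IndepFun.prodMk_assoc {Ω α β δ : Type*} [MeasurableSpace Ω]
    [MeasurableSpace α] [MeasurableSpace β] [MeasurableSpace δ] {P : Measure Ω}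
    [IsProbabilityMeasure P] {X : Ω → α} {Y : Ω → β} {Z : Ω → δ} (hX : Measurable X)
    (hY : Measurable Y) (hZ : Measurable Z) (hXY : IndepFun X Y P)
    (hXYZ : IndepFun (fun ω => (X ω, Y ω)) Z P) : IndepFun X (fun ω => (Y ω, Z ω)) P := by
  have hYZ : IndepFun Y Z P := hXYZ.comp measurable_snd measurable_id
  rw [indepFun_iff_map_prod_eq_prod_map_map (by fun_prop) (by fun_prop)] at *
  have := Measure.isProbabilityMeasure_map (μ := P) hX.aemeasurable
  have := Measure.isProbabilityMeasure_map (μ := P) hY.aemeasurable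
  have := Measure.isProbabilityMeasure_map (μ := P) hZ.aemeasurable
  rw [hYZ, ← Measure.prodAssoc_prod, ← hXY, ← hXYZ, Measure.map_map (by fun_prop) (by fun_prop)]
  rfl

/-! ### Counts of independent Poisson processes -/

section

variable {ι Ω : Type*} [MeasurableSpace Ω] {P : Measure Ω}

lemma IsPoissonProcess.finite {T : Ω → Set ℝ} {lam : ℝ → ℝ} (h : IsPoissonProcess P T lam) (ω : Ω)
    (a b : ℝ) : (T ω ∩ Ioc a b).Finite :=
  finite_inter_Ioc (h.pos ω) (h.locallyFinite ω) a b

lemma IsPoissonProcess.intervalIntegrable {T : Ω → Set ℝ} {lam : ℝ → ℝ}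
    (h : IsPoissonProcess P T lam) {a b : ℝ} (ha : 0 ≤ a) (hb : 0 ≤ b) :
    IntervalIntegrable lam volume a b :=
  (h.intensity_integrable a ha).symm.trans (h.intensity_integrable b hb)

lemma IsPoissonProcess.integral_nonneg {T : Ω → Set ℝ} {lam : ℝ → ℝ}
    (h : IsPoissonProcess P T lam) {a b : ℝ} (ha : 0 ≤ a) (hab : a ≤ b) :
    0 ≤ ∫ x in a..b, lam x := by
  rw [intervalIntegral.integral_of_le hab]
  exact setIntegral_nonneg measurableSet_Ioc
    fun x hx => h.intensity_nonneg x (ha.trans_lt hx.1)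

lemma IsPoissonProcess.hasLaw {T : Ω → Set ℝ} {lam : ℝ → ℝ} (h : IsPoissonProcess P T lam)
    {a b : ℝ} (ha : 0 ≤ a) (hab : a ≤ b) :
    HasLaw (fun ω => numPosts (T ω) a b) (poissonMeasure (∫ x in a..b, lam x).toNNReal) P :=
  ⟨(h.measurable_numPosts a b).aemeasurable, h.law a b ha hab⟩

lemma IsPoissonProcess.integrable_numPosts {T : Ω → Set ℝ} {lam : ℝ → ℝ}
    (h : IsPoissonProcess P T lam) {a b : ℝ} (ha : 0 ≤ a) (hab : a ≤ b) :
    Integrable (fun ω => (numPosts (T ω) a b : ℝ)) P := by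
  have := integrable_natCast_poissonMeasure (∫ x in a..b, lam x).toNNReal
  rw [← h.law a b ha hab] at this
  exact this.comp_measurable (h.measurable_numPosts a b)

lemma IsPoissonProcess.integral_numPosts {T : Ω → Set ℝ} {lam : ℝ → ℝ}
    (h : IsPoissonProcess P T lam) {a b : ℝ} (ha : 0 ≤ a) (hab : a ≤ b) :
    ∫ ω, (numPosts (T ω) a b : ℝ) ∂P = ∫ x in a..b, lam x := by
  have := (h.hasLaw ha hab).integral_comp (f := fun n : ℕ => (n : ℝ))
    Measurable.of_discrete.aestronglyMeasurable
  rw [integral_natCast_poissonMeasure, Real.coe_toNNReal _ (h.integral_nonneg ha hab)] at this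
  exact this

variable {T : ι → Ω → Set ℝ} {rate : ι → ℝ → ℝ} {R : Finset ι} {s : ι}

lemma measurable_process (hT : ∀ r, IsPoissonProcess P (T r) (rate r)) (r : ι) :
    Measurable fun ω (I : ℝ × ℝ) => numPosts (T r ω) I.1 I.2 :=
  measurable_pi_lambda _ fun I => (hT r).measurable_numPosts I.1 I.2

lemma intervalIntegrable_sum_rate (hT : ∀ r, IsPoissonProcess P (T r) (rate r)) (R : Finset ι)
    {a b : ℝ} (ha : 0 ≤ a) (hb : 0 ≤ b) :
    IntervalIntegrable (fun x => ∑ r ∈ R, rate r x) volume a b := by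
  have : IntervalIntegrable (∑ r ∈ R, rate r) volume a b :=
    .sum _ fun r _ => (hT r).intervalIntegrable ha hb
  rwa [Finset.sum_fn] at this

lemma integral_sum_rate_nonneg (hT : ∀ r, IsPoissonProcess P (T r) (rate r)) (R : Finset ι)
    {a b : ℝ} (ha : 0 ≤ a) (hab : a ≤ b) : 0 ≤ ∫ x in a..b, ∑ r ∈ R, rate r x := by
  rw [intervalIntegral.integral_finsetSum
    fun r _ => (hT r).intervalIntegrable ha (ha.trans hab)]
  exact Finset.sum_nonneg fun r _ => (hT r).integral_nonneg ha hab

/-- The superposition of independent Poisson processes. -/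
lemma hasLaw_sum_numPosts (hT : ∀ r, IsPoissonProcess P (T r) (rate r))
    (hind : IndepProcesses P T) [IsProbabilityMeasure P] {a b : ℝ} (ha : 0 ≤ a) (hab : a ≤ b)
    (R : Finset ι) :
    HasLaw (∑ r ∈ R, fun ω => numPosts (T r ω) a b)
      (poissonMeasure (∫ x in a..b, ∑ r ∈ R, rate r x).toNNReal) P := by
  classical
  have hi : iIndepFun (fun r ω => numPosts (T r ω) a b) P :=
    iIndepFun.comp hind (fun _ N => N (a, b)) fun _ => measurable_pi_apply _
  induction R using Finset.induction_on with
  | empty =>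
    simp only [Finset.sum_empty, intervalIntegral.integral_zero, Real.toNNReal_zero,
      poissonMeasure_zero]
    refine ⟨aemeasurable_const, ?_⟩
    change Measure.map (fun _ => 0) P = _
    simp [Measure.map_const]
  | insert r R hr ih =>
    have h1 := (hi.indepFun_finsetSum_of_notMem (fun r => (hT r).measurable_numPosts a b)
      hr).symm.hasLaw_add_poissonMeasure ((hT r).hasLaw ha hab) ih
    have hb := ha.trans hab
    rw [Finset.sum_insert hr]
    simp only [Finset.sum_insert hr]
    rw [intervalIntegral.integral_add ((hT r).intervalIntegrable ha hb)
      (intervalIntegrable_sum_rate hT R ha hb), Real.toNNReal_add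
      ((hT r).integral_nonneg ha hab) (integral_sum_rate_nonneg hT R ha hab)]
    exact h1

/-- The number of points of one process in `(a, b]` is independent of the total number of points
in `(b, t]`, to which the same process contributes. -/
lemma indepFun_numPosts_sum (hT : ∀ r, IsPoissonProcess P (T r) (rate r))
    (hind : IndepProcesses P T) [IsProbabilityMeasure P] (hs : s ∈ R) {a b t : ℝ} (ha : 0 ≤ a)
    (hab : a ≤ b) (hbt : b ≤ t) :
    IndepFun (fun ω => numPosts (T s ω) a b) (fun ω => ∑ r ∈ R, numPosts (T r ω) b t) P := by
  classical
  have hm : ∀ r a b, Measurable fun ω => numPosts (T r ω) a b :=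
    fun r => (hT r).measurable_numPosts
  have hXY : IndepFun (fun ω => numPosts (T s ω) a b) (fun ω => numPosts (T s ω) b t) P := by
    have hmono : Monotone fun n : ℕ => if n = 0 then a else if n = 1 then b else t := by
      refine monotone_nat_of_le_succ fun n => ?_
      rcases n with _ | _ | n <;> simp [hab, hbt]
    have := ((hT s).indep (fun n => if n = 0 then a else if n = 1 then b else t) (by simpa using ha)
      hmono).indepFun (zero_ne_one)
    simpa using this
  have hZ : IndepFun (fun ω => (numPosts (T s ω) a b, numPosts (T s ω) b t))
      (fun ω => ∑ r ∈ R.erase s, numPosts (T r ω) b t) P := by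
    have h := iIndepFun.indepFun_finset {s} (R.erase s) (by simp) hind (measurable_process hT)
    have h2 := h.comp
      (φ := fun N : {r // r ∈ ({s} : Finset ι)} → ℝ × ℝ → ℕ =>
        (N ⟨s, Finset.mem_singleton_self s⟩ (a, b), N ⟨s, Finset.mem_singleton_self s⟩ (b, t)))
      (ψ := fun N : {r // r ∈ R.erase s} → ℝ × ℝ → ℕ => ∑ r, N r (b, t))
      (by fun_prop) (by fun_prop)
    convert! h2 using 1
    funext ω
    exact (Finset.sum_coe_sort (R.erase s) fun r => numPosts (T r ω) b t).symm
  have h := IndepFun.prodMk_assoc (hm s a b) (hm s b t)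
    (Finset.measurable_fun_sum _ fun r _ => hm r b t) hXY hZ
  have h2 := h.comp (φ := id) (ψ := fun p : ℕ × ℕ => p.1 + p.2) measurable_id (by fun_prop)
  convert! h2 using 1
  funext ω
  exact (Finset.add_sum_erase R (fun r => numPosts (T r ω) b t) hs).symm

/-- The expected number of points of one process in a cell `(a, b]`, counted on the event that
fewer than `K` points arrive during `(b, t]`. -/
lemma integral_numPosts_mul_indicator (K : ℕ) (hT : ∀ r, IsPoissonProcess P (T r) (rate r))
    (hind : IndepProcesses P T) [IsProbabilityMeasure P] (hs : s ∈ R) {a b t : ℝ} (ha : 0 ≤ a)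
    (hab : a ≤ b) (hbt : b ≤ t) :
    ∫ ω, (numPosts (T s ω) a b : ℝ) *
        {m : ℕ | m < K}.indicator 1 (∑ r ∈ R, numPosts (T r ω) b t) ∂P =
      (∫ x in a..b, rate s x) * poissonBelow K (∫ x in b..t, ∑ r ∈ R, rate r x) := by
  have hi := (indepFun_numPosts_sum hT hind hs ha hab hbt).comp
    (φ := fun n : ℕ => (n : ℝ)) (ψ := fun n => {m : ℕ | m < K}.indicator (1 : ℕ → ℝ) n)
    Measurable.of_discrete Measurable.of_discrete
  have hmeas : Measurable fun ω => ∑ r ∈ R, numPosts (T r ω) b t :=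
    Finset.measurable_fun_sum _ fun r _ => (hT r).measurable_numPosts b t
  have hmul := hi.integral_fun_mul_eq_mul_integral
    (Measurable.of_discrete.comp ((hT s).measurable_numPosts a b)).aestronglyMeasurable
    (Measurable.of_discrete.comp hmeas).aestronglyMeasurable
  simp only [Function.comp_apply] at hmul
  rw [hmul, (hT s).integral_numPosts ha hab]
  congr 1
  have hb := ha.trans hab
  have hl := (hasLaw_sum_numPosts hT hind hb hbt R).integral_comp
    (f := {m : ℕ | m < K}.indicator (1 : ℕ → ℝ)) Measurable.of_discrete.aestronglyMeasurable
  rw [integral_indicator_one .of_discrete, poissonMeasure_real_Iio, Real.coe_toNNReal] at hl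
  · rw [← hl]
    simp
  · exact integral_sum_rate_nonneg hT R hb hbt

/-! ### The expected top count -/

lemma measurable_cells (K : ℕ) (hT : ∀ r, IsPoissonProcess P (T r) (rate r)) (t δ : ℝ) (n : ℕ) :
    Measurable fun ω => ∑ k ∈ Finset.range n,
      (numPosts (T s ω) (k * δ) ((k + 1 : ℕ) * δ) : ℝ) *
        {m : ℕ | m < K}.indicator 1 (∑ r ∈ R, numPosts (T r ω) ((k + 1 : ℕ) * δ) t) := by
  refine Finset.measurable_fun_sum _ fun k _ => Measurable.mul ?_ ?_
  · exact Measurable.of_discrete.comp ((hT s).measurable_numPosts _ _)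
  · exact Measurable.of_discrete.comp (g := {m : ℕ | m < K}.indicator (1 : ℕ → ℝ))
      (Finset.measurable_fun_sum _ fun r _ => (hT r).measurable_numPosts _ _)

lemma measurable_countTop (K : ℕ) (hT : ∀ r, IsPoissonProcess P (T r) (rate r)) (t : ℝ) :
    Measurable fun ω => (countTop K T R s t ω : ℝ) := by
  rcases le_or_gt t 0 with ht | ht
  · simp [countTop, Ioc_eq_empty_of_le ht]
  · exact measurable_of_tendsto_metrizable (fun n => measurable_cells K hT t _ (n + 1))
      (tendsto_pi_nhds.2 fun ω =>
        tendsto_sum_cells_countTop (fun r a b => (hT r).finite ω a b) ht)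

/-- The expected top count, by passing to the limit along partitions of `(0, t]`. -/
lemma integral_countTop (K : ℕ) (hT : ∀ r, IsPoissonProcess P (T r) (rate r))
    (hind : IndepProcesses P T) [IsProbabilityMeasure P] (hs : s ∈ R) {t : ℝ} (ht : 0 < t) :
    ∫ ω, (countTop K T R s t ω : ℝ) ∂P =
      expectedTop K (fun x => ∑ r ∈ R, rate r x) (rate s) t := by
  have hδ : ∀ n : ℕ, 0 < t / (n + 1 : ℕ) := fun n => by positivity
  have hfin : ∀ ω r a b, (T r ω ∩ Ioc a b).Finite := fun ω r a b => (hT r).finite ω a b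
  have hcell : ∀ n : ℕ, ((n + 1 : ℕ) : ℝ) * (t / (n + 1 : ℕ)) = t :=
    fun n => mul_div_cancel₀ t (by positivity)
  have hcellle : ∀ n : ℕ, ∀ k ∈ Finset.range (n + 1),
      ((k + 1 : ℕ) : ℝ) * (t / (n + 1 : ℕ)) ≤ t := fun n k hk => by
    have : ((k + 1 : ℕ) : ℝ) ≤ (n + 1 : ℕ) := by
      exact_mod_cast Nat.succ_le_of_lt (Finset.mem_range.1 hk)
    calc _ ≤ ((n + 1 : ℕ) : ℝ) * (t / (n + 1 : ℕ)) := by gcongr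
      _ = t := hcell n
  have hcell1 : ∀ n k : ℕ, (k : ℝ) * (t / (n + 1 : ℕ)) ≤ (k + 1 : ℕ) * (t / (n + 1 : ℕ)) :=
    fun n k => by gcongr; simp
  have hind1 : ∀ m : ℕ, 0 ≤ {m : ℕ | m < K}.indicator (1 : ℕ → ℝ) m ∧
      {m : ℕ | m < K}.indicator (1 : ℕ → ℝ) m ≤ 1 := fun m => by
    by_cases h : m < K <;> simp [h]
  -- The expectations converge by domination by the number of points in `(0, t]`.
  have hleft : Tendsto (fun n : ℕ => ∫ ω, ∑ k ∈ Finset.range (n + 1),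
      (numPosts (T s ω) (k * (t / (n + 1 : ℕ))) ((k + 1 : ℕ) * (t / (n + 1 : ℕ))) : ℝ) *
        {m : ℕ | m < K}.indicator 1
          (∑ r ∈ R, numPosts (T r ω) ((k + 1 : ℕ) * (t / (n + 1 : ℕ))) t) ∂P)
      atTop (𝓝 (∫ ω, (countTop K T R s t ω : ℝ) ∂P)) := by
    refine tendsto_integral_of_dominated_convergence (fun ω => (numPosts (T s ω) 0 t : ℝ))
      (fun n => (measurable_cells K hT t _ (n + 1)).aestronglyMeasurable)
      ((hT s).integrable_numPosts le_rfl ht.le) (fun n => .of_forall fun ω => ?_)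
      (.of_forall fun ω => tendsto_sum_cells_countTop (hfin ω) ht)
    rw [Real.norm_of_nonneg (Finset.sum_nonneg fun k _ =>
      mul_nonneg (Nat.cast_nonneg _) (hind1 _).1)]
    have hsum := sum_numPosts_mul_eq_finsum (hfin ω s) (hδ n) (fun _ => 1) (n + 1)
    rw [hcell, finsum_mem_eq_finite_toFinset_sum _ (hfin ω s 0 t), Finset.sum_const,
      nsmul_eq_mul, mul_one, ← ncard_eq_toFinset_card _ (hfin ω s 0 t)] at hsum
    rw [numPosts, ← hsum]
    exact Finset.sum_le_sum fun k _ =>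
      mul_le_mul_of_nonneg_left (hind1 _).2 (Nat.cast_nonneg _)
  have hlamint : IntervalIntegrable (fun x => ∑ r ∈ R, rate r x) volume 0 t :=
    intervalIntegrable_sum_rate hT R le_rfl ht.le
  -- The expectations are integrals with the tail probability taken at the end of the cell.
  have hsum : ∀ n : ℕ, ∫ ω, ∑ k ∈ Finset.range (n + 1),
      (numPosts (T s ω) (k * (t / (n + 1 : ℕ))) ((k + 1 : ℕ) * (t / (n + 1 : ℕ))) : ℝ) *
        {m : ℕ | m < K}.indicator 1
          (∑ r ∈ R, numPosts (T r ω) ((k + 1 : ℕ) * (t / (n + 1 : ℕ))) t) ∂P =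
      ∫ x in (0 : ℝ)..t, rate s x *
        poissonBelow K (∫ y in (roundUp (t / (n + 1 : ℕ)) x)..t, ∑ r ∈ R, rate r y) := by
    intro n
    set δ : ℝ := t / (n + 1 : ℕ)
    have hk0 : ∀ k : ℕ, 0 ≤ (k : ℝ) * δ := fun k => mul_nonneg (Nat.cast_nonneg _) (hδ n).le
    have hrate : ∀ k : ℕ, IntervalIntegrable (rate s) volume (k * δ) ((k + 1 : ℕ) * δ) :=
      fun k => (hT s).intervalIntegrable (hk0 k) (hk0 (k + 1))
    have hcongr : ∀ k : ℕ, ∀ x ∈ uIoc ((k : ℝ) * δ) ((k + 1 : ℕ) * δ),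
        rate s x * poissonBelow K (∫ y in ((k + 1 : ℕ) * δ)..t, ∑ r ∈ R, rate r y) =
        rate s x * poissonBelow K (∫ y in (roundUp δ x)..t, ∑ r ∈ R, rate r y) := by
      intro k x hx
      rw [uIoc_of_le (hcell1 n k)] at hx
      rw [roundUp_eq (hδ n) hx]
    rw [integral_finsetSum]
    · have h := intervalIntegral.sum_integral_adjacent_intervals (μ := volume) (n := n + 1)
        (a := fun k : ℕ => (k : ℝ) * δ)
        (f := fun x => rate s x * poissonBelow K (∫ y in (roundUp δ x)..t, ∑ r ∈ R, rate r y))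
        (fun k _ => ((hrate k).mul_const _).congr (hcongr k))
      simp only [Nat.cast_zero, zero_mul] at h
      rw [hcell n] at h
      rw [← h]
      refine Finset.sum_congr rfl fun k hk => ?_
      rw [integral_numPosts_mul_indicator K hT hind hs (hk0 k) (hcell1 n k) (hcellle n k hk),
        ← intervalIntegral.integral_mul_const]
      exact intervalIntegral.integral_congr_ae (.of_forall (hcongr k))
    · intro k _
      refine ((hT s).integrable_numPosts (hk0 k) (hcell1 n k)).mul_bdd (c := 1)
        (Measurable.of_discrete.comp (g := {m : ℕ | m < K}.indicator (1 : ℕ → ℝ))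
          (Finset.measurable_fun_sum _ fun r _ =>
            (hT r).measurable_numPosts _ _)).aestronglyMeasurable (.of_forall fun ω => ?_)
      rw [Real.norm_of_nonneg (hind1 _).1]
      exact (hind1 _).2
  -- These integrals converge, as the tail probability is continuous and bounded by one.
  have hright : Tendsto (fun n : ℕ => ∫ x in (0 : ℝ)..t, rate s x *
        poissonBelow K (∫ y in (roundUp (t / (n + 1 : ℕ)) x)..t, ∑ r ∈ R, rate r y))
      atTop (𝓝 (expectedTop K (fun x => ∑ r ∈ R, rate r x) (rate s) t)) := by
    have hmem : ∀ x ∈ Ioc 0 t, ∀ n : ℕ, roundUp (t / (n + 1 : ℕ)) x ∈ Icc 0 t := fun x hx n => by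
      refine ⟨hx.1.le.trans (le_roundUp (hδ n) x), ?_⟩
      have : (⌈x / (t / (n + 1 : ℕ))⌉ : ℝ) ≤ (n + 1 : ℕ) := by
        have : ⌈x / (t / (n + 1 : ℕ))⌉ ≤ ((n + 1 : ℕ) : ℤ) := by
          rw [Int.ceil_le, div_le_iff₀ (hδ n), Int.cast_natCast, hcell]
          exact hx.2
        exact_mod_cast this
      calc roundUp (t / (n + 1 : ℕ)) x ≤ ((n + 1 : ℕ) : ℝ) * (t / (n + 1 : ℕ)) :=
            mul_le_mul_of_nonneg_right this (hδ n).le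
        _ = t := hcell n
    refine intervalIntegral.tendsto_integral_filter_of_dominated_convergence (fun x => ‖rate s x‖)
      (.of_forall fun n => ?_) (.of_forall fun n => .of_forall fun x hx => ?_)
      ((hT s).intensity_integrable t ht.le).norm (.of_forall fun x hx => ?_)
    · refine ((hT s).intensity_integrable t ht.le).def'.aestronglyMeasurable.mul
        (Measurable.aestronglyMeasurable ?_)
      exact Measurable.of_discrete.comp (g := fun k : ℤ =>
        poissonBelow K (∫ y in (k * (t / (n + 1 : ℕ)))..t, ∑ r ∈ R, rate r y))
        (Int.measurable_ceil.comp (measurable_id.div_const _))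
    · rw [uIoc_of_le ht.le] at hx
      have h0 := integral_sum_rate_nonneg hT R (hmem x hx n).1 (hmem x hx n).2
      rw [norm_mul, Real.norm_of_nonneg (poissonBelow_nonneg K h0)]
      exact mul_le_of_le_one_right (norm_nonneg _) (poissonBelow_le_one K h0)
    · rw [uIoc_of_le ht.le] at hx
      refine Tendsto.const_mul _ (((continuous_poissonBelow K).tendsto _).comp ?_)
      have hcont := continuousOn_integral_left hlamint x (by
        rw [uIcc_of_le ht.le]; exact Ioc_subset_Icc_self hx)
      rw [uIcc_of_le ht.le] at hcont
      exact hcont.tendsto.comp (tendsto_nhdsWithin_iff.2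
        ⟨(tendsto_roundUp ht x).mono_right nhdsWithin_le_nhds, .of_forall (hmem x hx)⟩)
  simp only [hsum] at hleft
  exact tendsto_nhds_unique hleft hright

end

section

variable {ι Ω : Type*} [MeasurableSpace Ω] {P : Measure Ω} {T : ι → Ω → Set ℝ} {rate : ι → ℝ → ℝ}
  {R : Finset ι} {s : ι}

/-- A right-continuous step process is jointly measurable in time and outcome. -/
lemma measurable_prod_of_eventually_eq {G : ℝ → Ω → ℝ} (hG : ∀ t, Measurable (G t))
    (hr : ∀ t ω, ∀ᶠ c in 𝓝[≥] t, G c ω = G t ω) : Measurable fun p : ℝ × Ω => G p.1 p.2 := by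
  refine measurable_of_tendsto_metrizable
    (f := fun (n : ℕ) (p : ℝ × Ω) => G (roundUp (1 / (n + 1 : ℕ)) p.1) p.2)
    (fun n => ?_) (tendsto_pi_nhds.2 fun p => ?_)
  · generalize 1 / ((n + 1 : ℕ) : ℝ) = δ
    have h : Measurable fun q : ℤ × Ω => G (q.1 * δ) q.2 :=
      measurable_from_prod_countable_right fun k => hG (k * δ)
    have hc : Measurable fun p : ℝ × Ω => (⌈p.1 / δ⌉, p.2) := by fun_prop
    exact h.comp hc
  · refine tendsto_const_nhds.congr' ?_
    filter_upwards [(tendsto_roundUp one_pos p.1).eventually (hr p.1 p.2)] with n hn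
    exact hn.symm

lemma measurable_countTop_prod (K : ℕ) (hT : ∀ r, IsPoissonProcess P (T r) (rate r)) (hs : s ∈ R) :
    Measurable fun p : ℝ × Ω => (countTop K T R s p.1 p.2 : ℝ) := by
  refine measurable_prod_of_eventually_eq (G := fun t ω => (countTop K T R s t ω : ℝ))
    (fun t => measurable_countTop K hT t) fun t ω => ?_
  filter_upwards [eventually_countTop_eq (K := K) (fun r a b => (hT r).finite ω a b) hs t]
    with c hc
  rw [hc]

lemma integrable_countTop_prod (K : ℕ) (hT : ∀ r, IsPoissonProcess P (T r) (rate r)) (hs : s ∈ R)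
    [IsProbabilityMeasure P] (a : ℝ) {b : ℝ} (hb : 0 ≤ b) :
    Integrable (fun p : ℝ × Ω => (countTop K T R s p.1 p.2 : ℝ))
      ((volume.restrict (Ioc a b)).prod P) := by
  have hbound : Integrable (fun p : ℝ × Ω => (numPosts (T s p.2) 0 b : ℝ))
      ((volume.restrict (Ioc a b)).prod P) :=
    ((hT s).integrable_numPosts le_rfl hb).comp_snd _
  refine hbound.mono' (measurable_countTop_prod K hT hs).aestronglyMeasurable ?_
  have hmem : ∀ᵐ p ∂((volume.restrict (Ioc a b)).prod P), p.1 ∈ Ioc a b :=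
    Measure.quasiMeasurePreserving_fst.ae (ae_restrict_mem measurableSet_Ioc)
  filter_upwards [hmem] with p hp
  rw [Real.norm_of_nonneg (Nat.cast_nonneg _)]
  have hfin : ∀ r a b, (T r p.2 ∩ Ioc a b).Finite := fun r a b => (hT r).finite p.2 a b
  exact_mod_cast (countTop_le_numPosts hfin p.1).trans
    (ncard_le_ncard (inter_subset_inter_right _ (Ioc_subset_Ioc_right hp.2)) (hfin s 0 b))

lemma ae_integral_countTop (K : ℕ) (hT : ∀ r, IsPoissonProcess P (T r) (rate r))
    (hind : IndepProcesses P T) [IsProbabilityMeasure P] (hs : s ∈ R) {a : ℝ} (ha : 0 ≤ a) (b : ℝ) :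
    (fun t => ∫ ω, (countTop K T R s t ω : ℝ) ∂P) =ᵐ[volume.restrict (Ioc a b)]
      expectedTop K (fun x => ∑ r ∈ R, rate r x) (rate s) := by
  filter_upwards [ae_restrict_mem measurableSet_Ioc] with t ht
  exact integral_countTop K hT hind hs (ha.trans_lt ht.1)

lemma intervalIntegrable_expectedTop (K : ℕ) (hT : ∀ r, IsPoissonProcess P (T r) (rate r))
    (hind : IndepProcesses P T) [IsProbabilityMeasure P] (hs : s ∈ R) {a b : ℝ} (ha : 0 ≤ a)
    (hab : a ≤ b) :
    IntervalIntegrable (expectedTop K (fun x => ∑ r ∈ R, rate r x) (rate s)) volume a b := by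
  rw [intervalIntegrable_iff_integrableOn_Ioc_of_le hab]
  exact (integrable_countTop_prod K hT hs a (ha.trans hab)).integral_prod_left.congr
    (ae_integral_countTop K hT hind hs ha b)

lemma integral_intervalIntegral_countTop (K : ℕ)
    (hT : ∀ r, IsPoissonProcess P (T r) (rate r)) (hind : IndepProcesses P T)
    [IsProbabilityMeasure P] (hs : s ∈ R) {a b : ℝ} (ha : 0 ≤ a) (hab : a ≤ b) :
    ∫ ω, (∫ t in a..b, (countTop K T R s t ω : ℝ)) ∂P =
      ∫ t in a..b, expectedTop K (fun x => ∑ r ∈ R, rate r x) (rate s) t := by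
  simp only [intervalIntegral.integral_of_le hab]
  rw [← integral_integral_swap (integrable_countTop_prod K hT hs a (ha.trans hab))]
  exact integral_congr_ae (ae_integral_countTop K hT hind hs ha b)

end

/-! ### The visibility in terms of the intensities -/

section

variable {V Ω : Type*} [DecidableEq V] [MeasurableSpace Ω] {P : Measure Ω}
  {K : ℕ} {t₀ tf : ℝ} {B : Finset V} {E' : Finset (V × V)} {post feed : V → Ω → Set ℝ}
  {μ γ : V → ℝ → ℝ} {S : Finset (V × V)} {i j : V}

lemma sources_mono (B : Finset V) {S S' : Finset (V × V)} (h : S ⊆ S') (j : V) :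
    sources B S j ⊆ sources B S' j :=
  Finset.monotone_filter_right _ fun _ _ hi => h hi

/-- The visibility of one broadcaster is the time integral of the expected top count. -/
lemma edgeVisibility_eq  [IsProbabilityMeasure P]
    (hpost : ∀ i ∈ B, IsPoissonProcess P (post i) (μ i))
    (hfeed : IsPoissonProcess P (feed j) (γ j))
    (hindep : IndepProcesses P fun s : Option {i // i ∈ sources B E' j} =>
      s.elim (feed j) fun i => post i)
    (ht₀ : 0 ≤ t₀) (htf : t₀ ≤ tf) (hS : S ⊆ E') (hi : i ∈ sources B S j) :
    IntervalIntegrable (expectedTop K (feedIntensity B μ γ S j) (μ i)) volume t₀ tf ∧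
    edgeVisibility P K t₀ tf B post feed S i j =
      ∫ t in t₀..tf, expectedTop K (feedIntensity B μ γ S j) (μ i) t := by
  have hsub := sources_mono B hS j
  set T : Option {i // i ∈ sources B E' j} → Ω → Set ℝ := fun s =>
    s.elim (feed j) fun i => post i
  set rate : Option {i // i ∈ sources B E' j} → ℝ → ℝ := fun s => s.elim (γ j) fun i => μ i
  set R : Finset (Option {i // i ∈ sources B E' j}) :=
    Finset.insertNone ((sources B S j).subtype (· ∈ sources B E' j))
  have hT : ∀ s, IsPoissonProcess P (T s) (rate s) := by
    rintro (_ | s)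
    · exact hfeed
    · exact hpost s (Finset.mem_filter.1 s.2).1
  have hs : some ⟨i, hsub hi⟩ ∈ R := by simpa [R] using hi
  have hrate : (fun x => ∑ r ∈ R, rate r x) = feedIntensity B μ γ S j := by
    funext x
    rw [Finset.sum_insertNone, feedIntensity]
    congr 1
    exact Finset.sum_subtype_of_mem (fun i => μ i x) fun i hi => hsub hi
  have hcount : ∀ t ω, topCount K B post feed S i j t ω =
      countTop K T R (some ⟨i, hsub hi⟩) t ω := by
    intro t ω
    have : ∀ τ, received B post feed S j ω τ t = ∑ r ∈ R, numPosts (T r ω) τ t := fun τ => by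
      rw [Finset.sum_insertNone, received]
      congr 1
      exact (Finset.sum_subtype_of_mem (fun i => numPosts (post i ω) τ t) fun i hi => hsub hi).symm
    simp only [topCount, countTop, this]
    rfl
  rw [edgeVisibility]
  simp only [hcount]
  rw [← hrate]
  exact ⟨intervalIntegrable_expectedTop K hT hindep hs ht₀ htf,
    integral_intervalIntegral_countTop K hT hindep hs ht₀ htf⟩

lemma intervalIntegrable_feedIntensity (hpost : ∀ i ∈ B, IsPoissonProcess P (post i) (μ i))
    (hfeed : IsPoissonProcess P (feed j) (γ j)) (S : Finset (V × V)) {t : ℝ} (ht : 0 ≤ t) :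
    IntervalIntegrable (feedIntensity B μ γ S j) volume 0 t := by
  have h : IntervalIntegrable (∑ i ∈ sources B S j, μ i) volume 0 t :=
    .sum _ fun i hi => (hpost i (Finset.mem_filter.1 hi).1).intensity_integrable t ht
  rw [Finset.sum_fn] at h
  exact (hfeed.intensity_integrable t ht).add h

/-- The expected number of stories of the added broadcasters that are among the top `K` positions
of the feed of `j` at time `t`. -/
noncomputable def feedVisibility (K : ℕ) (B : Finset V) (μ γ : V → ℝ → ℝ) (S : Finset (V × V))
    (j : V) (t : ℝ) : ℝ :=
  expectedTop K (feedIntensity B μ γ S j) (fun x => feedIntensity B μ γ S j x - γ j x) t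

lemma feedVisibility_eq_sum (hpost : ∀ i ∈ B, IsPoissonProcess P (post i) (μ i))
    (hfeed : IsPoissonProcess P (feed j) (γ j)) (S : Finset (V × V)) {t : ℝ} (ht : 0 ≤ t) :
    feedVisibility K B μ γ S j t =
      ∑ i ∈ sources B S j, expectedTop K (feedIntensity B μ γ S j) (μ i) t := by
  have h : ∀ x, feedIntensity B μ γ S j x - γ j x = ∑ i ∈ sources B S j, μ i x :=
    fun x => add_sub_cancel_left _ _
  simp only [feedVisibility, h, expectedTop, Finset.sum_mul]
  exact intervalIntegral.integral_finsetSum fun i hi =>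
    intervalIntegrable_mul_poissonBelow K (intervalIntegrable_feedIntensity hpost hfeed S ht)
      ((hpost i (Finset.mem_filter.1 hi).1).intensity_integrable t ht)

lemma intervalIntegrable_feedVisibility  [IsProbabilityMeasure P]
    (hpost : ∀ i ∈ B, IsPoissonProcess P (post i) (μ i))
    (hfeed : IsPoissonProcess P (feed j) (γ j))
    (hindep : IndepProcesses P fun s : Option {i // i ∈ sources B E' j} =>
      s.elim (feed j) fun i => post i)
    (ht₀ : 0 ≤ t₀) (htf : t₀ ≤ tf) (hS : S ⊆ E') :
    IntervalIntegrable (feedVisibility K B μ γ S j) volume t₀ tf := by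
  have h : IntervalIntegrable
      (∑ i ∈ sources B S j, expectedTop K (feedIntensity B μ γ S j) (μ i)) volume t₀ tf :=
    .sum _ fun i hi => (edgeVisibility_eq hpost hfeed hindep ht₀ htf hS hi).1
  refine h.congr fun t ht => ?_
  rw [uIoc_of_le htf] at ht
  rw [feedVisibility_eq_sum hpost hfeed S (ht₀.trans ht.1.le), Finset.sum_apply]

lemma sum_edgeVisibility  [IsProbabilityMeasure P]
    (hpost : ∀ i ∈ B, IsPoissonProcess P (post i) (μ i))
    (hfeed : IsPoissonProcess P (feed j) (γ j))
    (hindep : IndepProcesses P fun s : Option {i // i ∈ sources B E' j} =>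
      s.elim (feed j) fun i => post i)
    (ht₀ : 0 ≤ t₀) (htf : t₀ ≤ tf) (hS : S ⊆ E') :
    ∑ i ∈ sources B S j, edgeVisibility P K t₀ tf B post feed S i j =
      ∫ t in t₀..tf, feedVisibility K B μ γ S j t := by
  have hi := fun i hi => edgeVisibility_eq (K := K) (i := i) hpost hfeed hindep ht₀ htf hS hi
  rw [Finset.sum_congr rfl fun i h => (hi i h).2,
    ← intervalIntegral.integral_finsetSum fun i h => (hi i h).1]
  refine intervalIntegral.integral_congr fun t ht => ?_
  rw [uIcc_of_le htf] at ht
  exact (feedVisibility_eq_sum hpost hfeed S (ht₀.trans ht.1)).symm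

lemma feedIntensity_insert {v : V} (hv : v ∈ B) (he : (v, j) ∉ S) :
    feedIntensity B μ γ (insert (v, j) S) j = fun x => feedIntensity B μ γ S j x + μ v x := by
  have hs : sources B (insert (v, j) S) j = insert v (sources B S j) := by
    ext i
    by_cases h : i = v <;> simp [sources, h, hv]
  have hv' : v ∉ sources B S j := fun h => he (Finset.mem_filter.1 h).2
  funext x
  rw [feedIntensity, hs, Finset.sum_insert hv', feedIntensity]
  ring

/-- A new link to `j` changes the feed of `j` only. -/
lemma marginal_visibility  [IsProbabilityMeasure P]
    (hE' : ∀ e ∈ E', e.1 ∈ B)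
    (hpost : ∀ i ∈ B, IsPoissonProcess P (post i) (μ i))
    (hfeed : ∀ j ∈ followers E', IsPoissonProcess P (feed j) (γ j))
    (hindep : ∀ j ∈ followers E',
      IndepProcesses P fun s : Option {i // i ∈ sources B E' j} =>
        s.elim (feed j) fun i => post i)
    (ht₀ : 0 ≤ t₀) (htf : t₀ ≤ tf) (hS : S ⊆ E') {v : V} (he : (v, j) ∈ E') (heS : (v, j) ∉ S) :
    IntervalIntegrable (broadcasterGain K (γ j) (feedIntensity B μ γ S j) (μ v)) volume t₀ tf ∧
    marginal (visibility P K t₀ tf B E' post feed) (v, j) S =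
      ∫ t in t₀..tf, broadcasterGain K (γ j) (feedIntensity B μ γ S j) (μ v) t := by
  have hj : j ∈ followers E' := Finset.mem_image_of_mem Prod.snd he
  have hS' : insert (v, j) S ⊆ E' := Finset.insert_subset he hS
  have hgain : broadcasterGain K (γ j) (feedIntensity B μ γ S j) (μ v) =
      fun t => feedVisibility K B μ γ (insert (v, j) S) j t - feedVisibility K B μ γ S j t := by
    funext t
    rw [broadcasterGain, feedVisibility, feedVisibility, feedIntensity_insert (hE' _ he) heS]
  have hi := fun (S : Finset (V × V)) (hS : S ⊆ E') =>
    intervalIntegrable_feedVisibility (K := K) hpost (hfeed j hj) (hindep j hj) ht₀ htf hS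
  rw [hgain]
  refine ⟨(hi _ hS').sub (hi _ hS), ?_⟩
  rw [intervalIntegral.integral_sub (hi _ hS') (hi _ hS), marginal, visibility, visibility,
    ← Finset.sum_sub_distrib, Finset.sum_eq_single j]
  · rw [sum_edgeVisibility hpost (hfeed j hj) (hindep j hj) ht₀ htf hS',
      sum_edgeVisibility hpost (hfeed j hj) (hindep j hj) ht₀ htf hS]
  · intro j' hj' hne
    have hs : sources B (insert (v, j) S) j' = sources B S j' := by
      simp [sources, hne]
    rw [sum_edgeVisibility hpost (hfeed j' hj') (hindep j' hj') ht₀ htf hS',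
      sum_edgeVisibility hpost (hfeed j' hj') (hindep j' hj') ht₀ htf hS]
    have : feedVisibility K B μ γ (insert (v, j) S) j' = feedVisibility K B μ γ S j' := by
      funext t
      have : feedIntensity B μ γ (insert (v, j) S) j' = feedIntensity B μ γ S j' := by
        funext x
        rw [feedIntensity, hs, feedIntensity]
      rw [feedVisibility, this, feedVisibility]
    rw [this, sub_self]
  · exact fun h => absurd hj h

end

/-! ### From the bounds on the intensities to the curvature -/

/-- A nonnegative `ξ`-bounded function lies between its infimum and `ξ` times its infimum. -/
lemma XiBounded.mem_Icc {ξ : ℝ} {I : Set ℝ} {f : ℝ → ℝ} (h : XiBounded ξ I f)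
    (h0 : ∀ x ∈ I, 0 ≤ f x) {x : ℝ} (hx : x ∈ I) :
    f x ∈ Icc (sInf (f '' I)) (ξ * sInf (f '' I)) :=
  ⟨csInf_le ⟨0, forall_mem_image.2 h0⟩ (mem_image_of_mem f hx),
    (le_csSup h.1 (mem_image_of_mem f hx)).trans h.2⟩

/-- If a nonnegative `ξ`-bounded function is positive at one point, then its infimum is positive,
and `ξ` is at least one. -/
lemma XiBounded.sInf_pos_and_one_le {ξ x : ℝ} {I : Set ℝ} {f : ℝ → ℝ} (h : XiBounded ξ I f)
    (h0 : ∀ x ∈ I, 0 ≤ f x) (hx : x ∈ I) (hpos : 0 < f x) : 0 < sInf (f '' I) ∧ 1 ≤ ξ := by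
  have h1 := h.mem_Icc h0 hx
  have h2 : 0 ≤ sInf (f '' I) := le_csInf ⟨_, mem_image_of_mem _ hx⟩ (forall_mem_image.2 h0)
  have h3 : 0 < sInf (f '' I) := by
    refine h2.lt_of_ne fun h => ?_
    rw [← h, mul_zero] at h1
    linarith [h1.2]
  refine ⟨h3, ?_⟩
  by_contra! h
  have := mul_lt_mul_of_pos_right h h3
  linarith [h1.1, h1.2]

section

variable {V : Type*} [DecidableEq V] {B : Finset V} {E' : Finset (V × V)} {μ γ : V → ℝ → ℝ}
  {j : V}

lemma feedIntensity_mono {A C : Finset (V × V)} (hAC : A ⊆ C) {x : ℝ}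
    (hμ : ∀ i ∈ B, 0 ≤ μ i x) : feedIntensity B μ γ A j x ≤ feedIntensity B μ γ C j x := by
  unfold feedIntensity
  gcongr
  · exact fun i hi _ => hμ i (Finset.mem_filter.1 hi).1
  · exact sources_mono B hAC j

lemma feedIntensity_empty : feedIntensity B μ γ ∅ j = γ j := by
  funext x
  simp [feedIntensity, sources]

end

/-- The factor in the curvature bound is at least `ξ ^ 2 + ξ`. -/
lemma le_curvatureBound {ξ ζ : ℝ} {K : ℕ} (hK : 1 ≤ K) (hξ : 1 ≤ ξ)
    (hζ : 4 * Real.exp (7 / 4) < ζ) : 1 - 1 / (ξ ^ 2 + ξ) ≤ curvatureBound ξ ζ K := by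
  have hζ0 : 0 < ζ := lt_trans (by positivity) hζ
  have hd0 : 0 < 1 - 4 * Real.exp (7 / 4) / ζ := by
    rw [sub_pos, div_lt_one hζ0]; exact hζ
  have hd1 : 1 - 4 * Real.exp (7 / 4) / ζ ≤ 1 := by
    have : 0 ≤ 4 * Real.exp (7 / 4) / ζ := by positivity
    linarith
  have hq : 1 ≤ 6.154 * Real.exp 2 / (1 - 4 * Real.exp (7 / 4) / ζ) := by
    rw [le_div_iff₀ hd0]
    have : (1 : ℝ) ≤ Real.exp 2 := Real.one_le_exp (by norm_num)
    linarith
  have hK1 : 1 ≤ √(K : ℝ) := by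
    rw [Real.one_le_sqrt]; exact_mod_cast hK
  have h : ξ ≤ 6.154 * Real.exp 2 / (1 - 4 * Real.exp (7 / 4) / ζ) * ξ * √(K : ℝ) := by
    have h1 := le_mul_of_one_le_left (by linarith : 0 ≤ ξ) hq
    exact h1.trans (le_mul_of_one_le_right (by linarith) hK1)
  unfold curvatureBound
  gcongr
  nlinarith

lemma IsAlphaSubmodular.exists_isGeneralizedCurvature {α : Type*} [DecidableEq α] {W : Finset α}
    {F : Finset α → ℝ} {a : ℝ} (ha1 : a ≤ 1) (ha : IsAlphaSubmodular W F a) {v : α} (hv : v ∈ W)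
    {A : Finset α} (hA : A ⊆ W) (hpos : 0 < marginal F v A) :
    ∃ b, IsGeneralizedCurvature W F b := by
  refine ⟨sInf {b : ℝ | b ≤ 1 ∧ IsAlphaSubmodular W F b}, ?_⟩
  have hbdd : BddBelow {b : ℝ | b ≤ 1 ∧ IsAlphaSubmodular W F b} := by
    -- The condition at `A = C` forces `b ≥ 0`.
    refine ⟨0, fun b hb => ?_⟩
    have := hb.2 v hv A A le_rfl hA
    by_contra! h
    nlinarith
  have hclosed : IsClosed {b : ℝ | b ≤ 1 ∧ IsAlphaSubmodular W F b} := by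
    simp only [IsAlphaSubmodular, ofPred_and, ofPred_forall]
    refine isClosed_Iic.inter ?_
    refine isClosed_iInter fun v => isClosed_iInter fun _ => isClosed_iInter fun A =>
      isClosed_iInter fun C => isClosed_iInter fun _ => isClosed_iInter fun _ => ?_
    exact isClosed_le (by fun_prop) continuous_const
  exact ⟨hclosed.csInf_mem ⟨a, ha1, ha⟩ hbdd, fun b hb => csInf_le hbdd hb⟩

end LinkRecommendation

theorem mainTheorem3 {V Ω : Type*} [DecidableEq V] [MeasurableSpace Ω]
    (P : Measure Ω) [IsProbabilityMeasure P]
    (K : ℕ) (hK : 1 ≤ K) (t₀ tf : ℝ) (ht₀ : 0 ≤ t₀) (htf : t₀ < tf)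
    (B : Finset V) (E' : Finset (V × V)) (hE' : ∀ e ∈ E', e.1 ∈ B)
    (post feed : V → Ω → Set ℝ) (μ γ : V → ℝ → ℝ)
    (hpost : ∀ i ∈ B, IsPoissonProcess P (post i) (μ i))
    (hfeed : ∀ j ∈ followers E', IsPoissonProcess P (feed j) (γ j))
    (hindep : ∀ j ∈ followers E',
      IndepProcesses P fun s : Option {i // i ∈ sources B E' j} =>
        s.elim (feed j) fun i => post i)
    (ξ ζ c₂ : ℝ)
    (hξ : ∀ S ⊆ E', ∀ j ∈ followers E', XiBounded ξ (Ioo 0 tf) (feedIntensity B μ γ S j))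
    (hc₂ : 0 < c₂) (hγ : ∀ j ∈ followers E', ∀ t ∈ Ioo t₀ tf, c₂ ≤ γ j t)
    (hζ : 4 * Real.exp (7 / 4) < ζ)
    (hmass : ∀ j ∈ followers E',
      (K : ℝ) - 1 + ζ * √((K : ℝ) - 1) ≤ ∫ x in (0 : ℝ)..t₀, γ j x) :
    IsAlphaSubmodular E' (visibility P K t₀ tf B E' post feed) (curvatureBound ξ ζ K) ∧
    (∀ α : ℝ, IsGeneralizedCurvature E' (visibility P K t₀ tf B E' post feed) α →
      α ≤ curvatureBound ξ ζ K) ∧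
    ((∃ e ∈ E', ∃ A ⊆ E', marginal (visibility P K t₀ tf B E' post feed) e A ≠ 0) →
      ∃ α : ℝ, IsGeneralizedCurvature E' (visibility P K t₀ tf B E' post feed) α) := by
  set F := visibility P K t₀ tf B E' post feed
  have hnu0 : ∀ i ∈ B, ∀ x, 0 < x → 0 ≤ μ i x := fun i hi => (hpost i hi).intensity_nonneg
  have hγ0 : ∀ j ∈ followers E', ∀ x, 0 < x → 0 ≤ γ j x :=
    fun j hj => (hfeed j hj).intensity_nonneg
  have hγle : ∀ j S x, 0 < x → γ j x ≤ feedIntensity B μ γ S j x := fun j S x hx => by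
    have := feedIntensity_mono (γ := γ) (j := j) (Finset.empty_subset S)
      fun i hi => hnu0 i hi x hx
    rwa [feedIntensity_empty] at this
  have hmem : ∀ e ∈ E', e.2 ∈ followers E' := fun e he => Finset.mem_image_of_mem Prod.snd he
  have hγξ : ∀ j ∈ followers E', XiBounded ξ (Ioo 0 tf) (γ j) := fun j hj => by
    simpa only [feedIntensity_empty] using hξ ∅ (Finset.empty_subset _) j hj
  have hinf : ∀ j ∈ followers E', 0 < sInf (γ j '' Ioo 0 tf) ∧ 1 ≤ ξ := fun j hj => by
    have hmid : (t₀ + tf) / 2 ∈ Ioo t₀ tf := ⟨by linarith, by linarith⟩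
    exact (hγξ j hj).sInf_pos_and_one_le (fun x hx => hγ0 j hj x hx.1)
      ⟨ht₀.trans_lt hmid.1, hmid.2⟩ (hc₂.trans_le (hγ j hj _ hmid))
  have hzero : ∀ e S, e ∈ S → marginal F e S = 0 := fun e S he => by
    rw [marginal, Finset.insert_eq_of_mem he, sub_self]
  have hnonneg : ∀ e ∈ E', ∀ S ⊆ E', 0 ≤ marginal F e S := by
    rintro ⟨v, j⟩ he S hS
    by_cases heS : (v, j) ∈ S
    · exact (hzero _ _ heS).ge
    have hj := hmem _ he
    rw [(marginal_visibility hE' hpost hfeed hindep ht₀ htf.le hS he heS).2]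
    refine intervalIntegral.integral_nonneg htf.le fun t ht => ?_
    have ht0 := ht₀.trans ht.1
    exact broadcasterGain_nonneg ht0 ((hfeed j hj).intensity_integrable t ht0)
      (intervalIntegrable_feedIntensity hpost (hfeed j hj) S ht0)
      ((hpost v (hE' _ he)).intensity_integrable t ht0) (fun x hx => hγ0 j hj x hx.1)
      (fun x hx => hγle j S x hx.1) (fun x hx => hnu0 v (hE' _ he) x hx.1)
  have hgain : ∀ e ∈ E', ∀ A C : Finset (V × V), A ⊆ C → C ⊆ E' →
      marginal F e C ≤ (ξ ^ 2 + ξ) * marginal F e A := by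
    rintro ⟨v, j⟩ he A C hAC hC
    have hj := hmem _ he
    obtain ⟨hg, hξ1⟩ := hinf j hj
    have hA := hAC.trans hC
    by_cases heC : (v, j) ∈ C
    · rw [hzero _ _ heC]
      exact mul_nonneg (by positivity) (hnonneg _ he A hA)
    have heA : (v, j) ∉ A := fun h => heC (hAC h)
    obtain ⟨hiA, hmA⟩ :=
      marginal_visibility (K := K) hE' hpost hfeed hindep ht₀ htf.le hA he heA
    obtain ⟨hiC, hmC⟩ :=
      marginal_visibility (K := K) hE' hpost hfeed hindep ht₀ htf.le hC he heC
    rw [hmA, hmC, ← intervalIntegral.integral_const_mul]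
    refine intervalIntegral.integral_mono_on htf.le hiC (hiA.const_mul _) fun t ht => ?_
    have ht0 := ht₀.trans ht.1
    have hsub : ∀ x ∈ Ioo 0 t, x ∈ Ioo 0 tf := fun x hx => ⟨hx.1, hx.2.trans_le ht.2⟩
    have hγI := fun x (hx : x ∈ Ioo 0 t) =>
      (hγξ j hj).mem_Icc (fun x hx => hγ0 j hj x hx.1) (hsub x hx)
    have hCI := fun x (hx : x ∈ Ioo 0 t) => (hξ C hC j hj).mem_Icc
      (fun x hx => (hγ0 j hj x hx.1).trans (hγle j C x hx.1)) (hsub x hx)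
    have hgc : sInf (γ j '' Ioo 0 tf) ≤ sInf (feedIntensity B μ γ C j '' Ioo 0 tf) := by
      refine le_csInf ((nonempty_Ioo.2 (ht₀.trans_lt htf)).image _) (forall_mem_image.2 ?_)
      intro x hx
      exact ((hγξ j hj).mem_Icc (fun x hx => hγ0 j hj x hx.1) hx).1.trans (hγle j C x hx.1)
    exact broadcasterGain_le ht0 ((hfeed j hj).intensity_integrable t ht0)
      (intervalIntegrable_feedIntensity hpost (hfeed j hj) A ht0)
      (intervalIntegrable_feedIntensity hpost (hfeed j hj) C ht0)
      ((hpost v (hE' _ he)).intensity_integrable t ht0) hg hgc hξ1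
      (fun x hx => (hγI x hx).1) (fun x hx => (hγI x hx).2)
      (fun x hx => (hCI x hx).1) (fun x hx => (hCI x hx).2)
      (fun x hx => hγle j A x hx.1)
      (fun x hx => feedIntensity_mono hAC fun i hi => hnu0 i hi x hx.1)
      (fun x hx => hnu0 v (hE' _ he) x hx.1)
  have hsub : IsAlphaSubmodular E' F (curvatureBound ξ ζ K) := by
    intro e he A C hAC hC
    have hξ1 := (hinf e.2 (hmem e he)).2
    have hpos : 0 < ξ ^ 2 + ξ := by positivity
    calc (1 - curvatureBound ξ ζ K) * marginal F e C
        ≤ 1 / (ξ ^ 2 + ξ) * marginal F e C :=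
          mul_le_mul_of_nonneg_right (by linarith [le_curvatureBound hK hξ1 hζ])
            (hnonneg e he C hC)
      _ ≤ 1 / (ξ ^ 2 + ξ) * ((ξ ^ 2 + ξ) * marginal F e A) :=
          mul_le_mul_of_nonneg_left (hgain e he A C hAC hC) (by positivity)
      _ = marginal F e A := by field_simp
  have hle1 : ∀ e ∈ E', curvatureBound ξ ζ K ≤ 1 := by
    intro e he
    have hξ1 := (hinf e.2 (hmem e he)).2
    have hd0 : 0 < 1 - 4 * Real.exp (7 / 4) / ζ := by
      rw [sub_pos, div_lt_one (lt_trans (by positivity) hζ)]; exact hζ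
    unfold curvatureBound
    have hξ0 : 0 < ξ := by linarith
    have : 0 ≤ 1 / (ξ * (6.154 * Real.exp 2 / (1 - 4 * Real.exp (7 / 4) / ζ) * ξ * √(K : ℝ) + 1)) :=
      by positivity
    linarith
  refine ⟨hsub, fun α hα => ?_, fun ⟨e, he, A, hA, hne⟩ => ?_⟩
  · rcases E'.eq_empty_or_nonempty with rfl | ⟨e, he⟩
    · -- Without candidate links every real number `≤ 1` qualifies, and there is no smallest one.
      have h : α - 1 ∈ {b : ℝ | b ≤ 1 ∧ IsAlphaSubmodular ∅ F b} :=
        ⟨by linarith [hα.1.1], fun v hv => absurd hv (Finset.notMem_empty v)⟩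
      linarith [hα.2 h]
    · exact hα.2 ⟨hle1 e he, hsub⟩
  · exact hsub.exists_isGeneralizedCurvature (hle1 e he) he hA
      ((hnonneg e he A hA).lt_of_ne' hne)
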